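/- Let $\ell\neq 0$ be real and let $\alpha\in(-\infty,-\tfrac23)\cup(\tfrac12,2)$. Consider the central force with potential $V(r)=-\tfrac1\alpha r^{-\alpha}$, and put $h^*=\frac{\alpha-2}{2\alpha}|\ell|^{2\alpha/(\alpha-2)}$. The energies $h$ of the bounded non-circular orbits of angular momentum $\ell$, i.e. those for which $h-V(r)-\frac{\ell^2}{2r^2}=0$ has two solutions $0<r_-(h)<r_+(h)$ with $V(r)+\frac{\ell^2}{2r^2}<h$ between them, form the interval $H=(h^*,0)$ if $\alpha>0$ and $H=(h^*,+\infty)$ if $\alpha<0$. For $h\in H$ let $$\Theta_\alpha(h)=\int_{r_-(h)}^{r_+(h)}\frac{|\ell|\,dr}{r^2\sqrt{2\left(h+\frac1\alpha r^{-\alpha}\right)-\frac{\ell^2}{r^2}}}$$ be the apsidal angle (the integral converges), and let $e(h)=\frac{r_+(h)-r_-(h)}{r_+(h)+r_-(h)}$ be the eccentricity. Then $\Theta_\alpha$ is a monotone (not necessarily strictly monotone) function of the energy $h$ on $H$. Moreover: * if $\alpha\in(-2,-\tfrac23)\cup(\tfrac12,1)$, then $\Theta_\alpha$ is differentiable and strictly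 decreasing on $H$, with $\Theta_\alpha'(h)<0$ for all $h\in H$; * if $\alpha\in(-\infty,-2)\cup(1,2)$, then $\Theta_\alpha$ is differentiable and strictly increasing on $H$, with $\Theta_\alpha'(h)>0$ for all $h\in H$. Furthermore, the eccentricity is a differentiable, strictly increasing function of the energy with $e'(h)>0$ on $H$. Consequently $\Theta_\alpha$ is a function of the eccentricity, that is, $\Theta_\alpha(h)=T(e(h))$ for a function $T$ on $e(H)$, and $T$ is monotone for all the above $\alpha$, strictly decreasing with $T'<0$ in the first case, and strictly increasing with $T'>0$ in the second. -/

import Mathlib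

noncomputable section

namespace ApsidalAngle

/-- The power-law potential `V(r) = -r^{-α}/α`. -/
def potential (α r : ℝ) : ℝ := -(1 / α) * r ^ (-α)

/-- The effective radial potential `V(r) + ℓ²/(2r²)`. -/
def effPotential (α ℓ r : ℝ) : ℝ := potential α r + ℓ ^ 2 / (2 * r ^ 2)

/-- The apsidal distances: the radii `r > 0` with `h - V(r) - ℓ²/(2r²) = 0`. -/
def apsides (α ℓ h : ℝ) : Set ℝ := {r | 0 < r ∧ h - potential α r - ℓ ^ 2 / (2 * r ^ 2) = 0}

/-- The energies of the bounded non-circular orbits of angular momentum `ℓ`: those for which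
the radial motion has two distinct turning points, with the region between them allowed. -/
def energies (α ℓ : ℝ) : Set ℝ :=
  {h | ∃ r₁ ∈ apsides α ℓ h, ∃ r₂ ∈ apsides α ℓ h, r₁ < r₂ ∧
    ∀ r ∈ Set.Ioo r₁ r₂, effPotential α ℓ r < h}

/-- The pericenter distance `r₋`. -/
def rMinus (α ℓ h : ℝ) : ℝ := sInf (apsides α ℓ h)

/-- The apocenter distance `r₊`. -/
def rPlus (α ℓ h : ℝ) : ℝ := sSup (apsides α ℓ h)

/-- The integrand of the apsidal angle. The angular momentum enters the numerator through its
absolute value, so that orbits of either orientation have a positive apsidal angle. -/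
def integrand (α ℓ h r : ℝ) : ℝ :=
  |ℓ| / (r ^ 2 * √(2 * (h - potential α r) - ℓ ^ 2 / r ^ 2))

/-- The apsidal angle `Θ_α(h)` at angular momentum `ℓ`. -/
def apsidalAngle (α ℓ h : ℝ) : ℝ :=
  ∫ r in (rMinus α ℓ h)..(rPlus α ℓ h), integrand α ℓ h r

/-- The orbital eccentricity `e = (r₊ - r₋)/(r₊ + r₋)`. -/
def eccentricity (α ℓ h : ℝ) : ℝ :=
  (rPlus α ℓ h - rMinus α ℓ h) / (rPlus α ℓ h + rMinus α ℓ h)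

/-- `f` is strictly decreasing on `s`, with a negative derivative at each point of `s`. -/
def DecreasesOn (f : ℝ → ℝ) (s : Set ℝ) : Prop :=
  StrictAntiOn f s ∧ ∀ x ∈ s, DifferentiableAt ℝ f x ∧ deriv f x < 0

/-- `f` is strictly increasing on `s`, with a positive derivative at each point of `s`. -/
def IncreasesOn (f : ℝ → ℝ) (s : Set ℝ) : Prop :=
  StrictMonoOn f s ∧ ∀ x ∈ s, DifferentiableAt ℝ f x ∧ 0 < deriv f x

end ApsidalAngle

end

noncomputable section

namespace ApsidalAngle

open Set Filter Topology MeasureTheory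

/-! ### Inverse functions, the oscillator potential, and the criteria of Schaaf and Chicone. -/

section

/-! A power `x = c * r ^ (-s)` turns the radial equation into the energy equation of an oscillator
with potential `U(x) = x²/2 - x^β/β`, at an energy `κ` that increases with `h`. For `0 < α < 2` it
is the inverse radius, with `s = 1` and `β = α`. For `α < 0` the dual exponent `β = 2α/(α-2)` is
used, and the energy term and the force potential exchange roles (`reducesTo_of_pos`,
`reducesTo_of_neg`). The apsidal angle is `1/s` times the half-period of this oscillator, and the
assumptions on `α` amount to `1/2 < β < 2`.

Put `E = U - U(1)` and `y = ±√(2E)`, so that an oscillation of amplitude `a` is `y = a sin θ`. Then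
`dx/dy = √(2R)` with `R = E/E'²`, and the half-period is `∫ √(2R(x(a sin θ))) dθ` over `[-π/2,
π/2]`, an integral without singularities. Its derivative in `a` is `∫ R'(x(a sin θ)) sin θ dθ`
(`hasDerivAt_oscAngle`). Pairing `θ` with `-θ` shows that its sign is decided once `R'` is strictly
monotone, which is Chicone's criterion.

The sign of `R''` is that of `chiconeExpr`. It still contains `E`; dividing by `schaafDenom` and
differentiating leaves Schaaf's expression `5E'''² - 3E''E''''`, whose sign can be read off. The
outcome is `R'' > 0` off `x = 1` for `1 < β < 2` (`chiconeExpr_pos`) and `R'' < 0` there for `1/2 <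
β < 1` (`chiconeExpr_neg`), while `R` is constant for `β = 1`.

The eccentricity also depends on `a` alone, with positive derivative, so the inverse function
theorem transfers everything from `h` to `e`. -/

/-- The inverse of a strictly increasing function with nonvanishing derivative on an open set. -/
theorem hasDerivAt_leftInverse {H : Set ℝ} (hH : IsOpen H) {g g' k : ℝ → ℝ}
    (hg : StrictMonoOn g H) (hd : ∀ x ∈ H, HasDerivAt g (g' x) x) (hk : ∀ x ∈ H, k (g x) = x)
    {x : ℝ} (hx : x ∈ H) (h0 : g' x ≠ 0) :
    g '' H ∈ 𝓝 (g x) ∧ HasDerivAt k (g' x)⁻¹ (g x) := by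
  have himg : g '' H ∈ 𝓝 (g x) := by
    obtain ⟨l, u, hxlu, hlu⟩ := mem_nhds_iff_exists_Ioo_subset.1 (hH.mem_nhds hx)
    obtain ⟨y, hy1, hy2⟩ := exists_between hxlu.1
    obtain ⟨z, hz1, hz2⟩ := exists_between hxlu.2
    have hsub : Icc y z ⊆ H := fun w hw => hlu ⟨hy1.trans_le hw.1, hw.2.trans_lt hz2⟩
    have hyz : y ≤ z := (hy2.trans hz1).le
    have hc : ContinuousOn g (Icc y z) :=
      fun w hw => (hd w (hsub hw)).continuousAt.continuousWithinAt
    refine mem_of_superset (Icc_mem_nhds (hg (hsub ⟨le_rfl, hyz⟩) hx hy2)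
      (hg hx (hsub ⟨hyz, le_rfl⟩) hz1)) ((intermediate_value_Icc hyz hc).trans (image_mono hsub))
  refine ⟨himg, ?_⟩
  have hmono : StrictMonoOn k (g '' H) := by
    rintro _ ⟨y, hy, rfl⟩ _ ⟨z, hz, rfl⟩ hlt
    rw [hk y hy, hk z hz]
    exact (hg.lt_iff_lt hy hz).1 hlt
  have himg2 : k '' (g '' H) = H := by
    ext y
    constructor
    · rintro ⟨_, ⟨z, hz, rfl⟩, rfl⟩
      rwa [hk z hz]
    · intro hy
      exact ⟨g y, ⟨y, hy, rfl⟩, hk y hy⟩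
  -- A monotone function whose image of a neighborhood is a neighborhood cannot jump; this
  -- continuity is what the derivative rule for inverses needs.
  have hcont : ContinuousAt k (g x) := by
    apply continuousAt_of_monotoneOn_of_image_mem_nhds hmono.monotoneOn himg
    rw [himg2, hk x hx]
    exact hH.mem_nhds hx
  refine HasDerivAt.of_local_left_inverse hcont (f := g) ?_ h0 ?_
  · rw [hk x hx]; exact hd x hx
  · filter_upwards [himg]
    rintro _ ⟨z, hz, rfl⟩
    rw [hk z hz]

/-- The potential `x²/2 - x^β/β` of the oscillator solved by the inverse radius. -/
def oscPotential (β x : ℝ) : ℝ := x ^ 2 / 2 - x ^ β / β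

/-- The oscillator potential, normalized to vanish at its minimum `x = 1`. -/
def oscExcess (β x : ℝ) : ℝ := oscPotential β x - oscPotential β 1

/-- The derivative of the oscillator potential. -/
def oscForce (β x : ℝ) : ℝ := x - x ^ (β - 1)

/-- The second derivative of the oscillator potential. -/
def oscForce₁ (β x : ℝ) : ℝ := 1 - (β - 1) * x ^ (β - 2)

/-- The third derivative of the oscillator potential. -/
def oscForce₂ (β x : ℝ) : ℝ := -((β - 1) * (β - 2)) * x ^ (β - 3)

/-- The fourth derivative of the oscillator potential. -/
def oscForce₃ (β x : ℝ) : ℝ := -((β - 1) * (β - 2) * (β - 3)) * x ^ (β - 4)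

variable {β x : ℝ}

theorem hasDerivAt_oscExcess (hβ : β ≠ 0) (hx : 0 < x) :
    HasDerivAt (oscExcess β) (oscForce β x) x := by
  have h1 := (Real.hasDerivAt_rpow_const (x := x) (p := β) (Or.inl hx.ne')).div_const β
  have h2 := ((hasDerivAt_pow 2 x).div_const 2).sub h1
  refine (h2.sub_const (oscPotential β 1)).congr_deriv ?_
  unfold oscForce
  field_simp
  norm_num
  ring

theorem hasDerivAt_oscForce (hx : 0 < x) : HasDerivAt (oscForce β) (oscForce₁ β x) x := by
  refine ((hasDerivAt_id x).sub
    (Real.hasDerivAt_rpow_const (x := x) (p := β - 1) (Or.inl hx.ne'))).congr_deriv ?_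
  unfold oscForce₁
  ring_nf

theorem hasDerivAt_oscForce₁ (hx : 0 < x) : HasDerivAt (oscForce₁ β) (oscForce₂ β x) x := by
  refine (((Real.hasDerivAt_rpow_const (x := x) (p := β - 2) (Or.inl hx.ne')).const_mul
    (β - 1)).const_sub 1).congr_deriv ?_
  unfold oscForce₂
  ring_nf

theorem hasDerivAt_oscForce₂ (hx : 0 < x) : HasDerivAt (oscForce₂ β) (oscForce₃ β x) x := by
  refine ((Real.hasDerivAt_rpow_const (x := x) (p := β - 3) (Or.inl hx.ne')).const_mul
    (-((β - 1) * (β - 2)))).congr_deriv ?_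
  unfold oscForce₃
  ring_nf

theorem oscExcess_one : oscExcess β 1 = 0 := sub_self _

theorem oscForce_one : oscForce β 1 = 0 := by simp [oscForce]

theorem oscForce_neg (hβ : β < 2) (hx : 0 < x) (hx1 : x < 1) : oscForce β x < 0 := by
  have := Real.rpow_lt_rpow_of_exponent_gt hx hx1 (show β - 1 < 1 by linarith)
  rw [Real.rpow_one] at this
  unfold oscForce
  linarith

theorem oscForce_pos (hβ : β < 2) (hx1 : 1 < x) : 0 < oscForce β x := by
  have := Real.rpow_lt_rpow_of_exponent_lt hx1 (show β - 1 < 1 by linarith)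
  rw [Real.rpow_one] at this
  unfold oscForce
  linarith

theorem oscForce_ne_zero (hβ : β < 2) (hx : 0 < x) (hx1 : x ≠ 1) : oscForce β x ≠ 0 := by
  rcases lt_or_gt_of_ne hx1 with h | h
  · exact (oscForce_neg hβ hx h).ne
  · exact (oscForce_pos hβ h).ne'

theorem continuousOn_oscExcess (hβ : β ≠ 0) : ContinuousOn (oscExcess β) (Ioi 0) :=
  fun _ hx => (hasDerivAt_oscExcess hβ hx).continuousAt.continuousWithinAt

theorem strictAntiOn_oscExcess (hβ0 : β ≠ 0) (hβ : β < 2) :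
    StrictAntiOn (oscExcess β) (Ioc 0 1) := by
  apply strictAntiOn_of_deriv_neg (convex_Ioc _ _)
    ((continuousOn_oscExcess hβ0).mono fun y hy => hy.1)
  intro y hy
  rw [interior_Ioc] at hy
  rw [(hasDerivAt_oscExcess hβ0 hy.1).deriv]
  exact oscForce_neg hβ hy.1 hy.2

theorem strictMonoOn_oscExcess (hβ0 : β ≠ 0) (hβ : β < 2) :
    StrictMonoOn (oscExcess β) (Ici 1) := by
  apply strictMonoOn_of_deriv_pos (convex_Ici _)
    ((continuousOn_oscExcess hβ0).mono fun y hy => mem_Ioi.2 (zero_lt_one.trans_le hy))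
  intro y hy
  rw [interior_Ici] at hy
  rw [(hasDerivAt_oscExcess hβ0 (zero_lt_one.trans hy)).deriv]
  exact oscForce_pos hβ hy

theorem oscExcess_pos (hβ0 : β ≠ 0) (hβ : β < 2) (hx : 0 < x) (hx1 : x ≠ 1) :
    0 < oscExcess β x := by
  rw [← oscExcess_one (β := β)]
  rcases lt_or_gt_of_ne hx1 with h | h
  · exact strictAntiOn_oscExcess hβ0 hβ ⟨hx, h.le⟩ ⟨zero_lt_one, le_rfl⟩ h
  · exact strictMonoOn_oscExcess hβ0 hβ self_mem_Ici h.le h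

/-- The denominator in the comparison function for Schaaf's criterion. -/
def schaafDenom (β x : ℝ) : ℝ := 6 * oscForce₁ β x ^ 2 - 2 * oscForce β x * oscForce₂ β x

/-- The comparison function for Schaaf's criterion. -/
def schaafAux (β x : ℝ) : ℝ :=
  oscExcess β x - 3 * oscForce β x ^ 2 * oscForce₁ β x / schaafDenom β x

/-- Schaaf's expression `5 f''² - 3 f' f'''`. -/
def schaafExpr (β x : ℝ) : ℝ := 5 * oscForce₂ β x ^ 2 - 3 * oscForce₁ β x * oscForce₃ β x

/-- Chicone's expression, the numerator of the second derivative of `E / E'²`. -/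
def chiconeExpr (β x : ℝ) : ℝ :=
  6 * oscExcess β x * oscForce₁ β x ^ 2 - 3 * oscForce β x ^ 2 * oscForce₁ β x
    - 2 * oscExcess β x * oscForce β x * oscForce₂ β x

theorem chiconeExpr_eq (hD : schaafDenom β x ≠ 0) :
    chiconeExpr β x = schaafDenom β x * schaafAux β x := by
  unfold schaafAux
  rw [mul_sub, mul_div_cancel₀ _ hD]
  unfold chiconeExpr schaafDenom
  ring

/-- In `schaafAux` the excess `E` stands alone with coefficient one, so differentiating removes it
and only derivatives of the potential remain. They combine into Schaaf's expression times `E'³`,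
which has the sign of `x - 1` when `β < 2`. -/
theorem hasDerivAt_schaafAux (hβ : β ≠ 0) (hx : 0 < x) (hD : schaafDenom β x ≠ 0) :
    HasDerivAt (schaafAux β) (2 * oscForce β x ^ 3 * schaafExpr β x / schaafDenom β x ^ 2) x := by
  have hE := hasDerivAt_oscExcess hβ hx
  have h0 := hasDerivAt_oscForce (β := β) hx
  have h1 := hasDerivAt_oscForce₁ (β := β) hx
  have h2 := hasDerivAt_oscForce₂ (β := β) hx
  have hDd : HasDerivAt (schaafDenom β) _ x :=
    ((h1.pow 2).const_mul 6).sub ((h0.const_mul 2).mul h2)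
  refine (hE.sub ((((h0.pow 2).const_mul 3).mul h1).div hDd hD)).congr_deriv ?_
  simp only [Pi.pow_apply, Pi.mul_apply]
  field_simp
  unfold schaafExpr schaafDenom
  push_cast
  ring

theorem schaafAux_one : schaafAux β 1 = 0 := by
  simp [schaafAux, oscExcess_one, oscForce_one]

theorem continuousOn_schaafAux {s : Set ℝ} (hβ : β ≠ 0) (hs : ∀ y ∈ s, 0 < y)
    (hD : ∀ y ∈ s, schaafDenom β y ≠ 0) : ContinuousOn (schaafAux β) s :=
  fun y hy => (hasDerivAt_schaafAux hβ (hs y hy) (hD y hy)).continuousAt.continuousWithinAt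

/-- Schaaf's criterion implies Chicone's, to the right of the minimum. -/
theorem sign_mul_schaafAux_right (σ : ℝ) (hβ0 : β ≠ 0) (hβ : β < 2) (hx : 1 < x)
    (hD : ∀ y ∈ Icc 1 x, 0 < schaafDenom β y) (hS : ∀ y ∈ Ioo 1 x, 0 < σ * schaafExpr β y) :
    0 < σ * schaafAux β x := by
  have hc : ContinuousOn (fun y => σ * schaafAux β y) (Icc 1 x) :=
    continuousOn_const.mul (continuousOn_schaafAux hβ0
      (fun y hy => zero_lt_one.trans_le hy.1) fun y hy => (hD y hy).ne')
  have hm : StrictMonoOn (fun y => σ * schaafAux β y) (Icc 1 x) := by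
    apply strictMonoOn_of_deriv_pos (convex_Icc _ _) hc
    intro y hy
    rw [interior_Icc] at hy
    have hDy := hD y ⟨hy.1.le, hy.2.le⟩
    rw [((hasDerivAt_schaafAux hβ0 (zero_lt_one.trans hy.1) hDy.ne').const_mul σ).deriv]
    have hf := oscForce_pos hβ hy.1
    have hSy := hS y hy
    rw [show σ * (2 * oscForce β y ^ 3 * schaafExpr β y / schaafDenom β y ^ 2)
      = 2 * oscForce β y ^ 3 * (σ * schaafExpr β y) / schaafDenom β y ^ 2 by ring]
    positivity
  have := hm ⟨le_rfl, hx.le⟩ ⟨hx.le, le_rfl⟩ hx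
  simpa [schaafAux_one] using this

/-- Schaaf's criterion implies Chicone's, to the left of the minimum. -/
theorem sign_mul_schaafAux_left (σ : ℝ) (hβ0 : β ≠ 0) (hβ : β < 2) (hx0 : 0 < x) (hx : x < 1)
    (hD : ∀ y ∈ Icc x 1, 0 < schaafDenom β y) (hS : ∀ y ∈ Ioo x 1, 0 < σ * schaafExpr β y) :
    0 < σ * schaafAux β x := by
  have hc : ContinuousOn (fun y => σ * schaafAux β y) (Icc x 1) :=
    continuousOn_const.mul (continuousOn_schaafAux hβ0
      (fun y hy => hx0.trans_le hy.1) fun y hy => (hD y hy).ne')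
  have hm : StrictAntiOn (fun y => σ * schaafAux β y) (Icc x 1) := by
    apply strictAntiOn_of_deriv_neg (convex_Icc _ _) hc
    intro y hy
    rw [interior_Icc] at hy
    have hDy := hD y ⟨hy.1.le, hy.2.le⟩
    rw [((hasDerivAt_schaafAux hβ0 (hx0.trans hy.1) hDy.ne').const_mul σ).deriv]
    have hf : 0 < - oscForce β y := neg_pos.2 (oscForce_neg hβ (hx0.trans hy.1) hy.2)
    have hSy := hS y hy
    rw [show σ * (2 * oscForce β y ^ 3 * schaafExpr β y / schaafDenom β y ^ 2)
      = -(2 * (-oscForce β y) ^ 3 * (σ * schaafExpr β y) / schaafDenom β y ^ 2) by ring]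
    exact neg_neg_of_pos (by positivity)
  have := hm ⟨le_rfl, hx.le⟩ ⟨hx.le, le_rfl⟩ hx
  simpa [schaafAux_one] using this

theorem oscForce_eq (hx : 0 < x) : oscForce β x = x * (1 - x ^ (β - 2)) := by
  unfold oscForce
  rw [show β - 1 = (β - 2) + 1 by ring, Real.rpow_add_one hx.ne']
  ring

theorem oscForce₂_eq (hx : 0 < x) :
    oscForce₂ β x = -((β - 1) * (β - 2)) * x ^ (β - 2) / x := by
  unfold oscForce₂
  rw [show β - 3 = (β - 2) - 1 by ring, Real.rpow_sub_one hx.ne']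
  ring

theorem oscForce₃_eq (hx : 0 < x) :
    oscForce₃ β x = -((β - 1) * (β - 2) * (β - 3)) * x ^ (β - 2) / x ^ 2 := by
  unfold oscForce₃
  rw [show β - 4 = (β - 2) - 1 - 1 by ring, Real.rpow_sub_one hx.ne', Real.rpow_sub_one hx.ne']
  field_simp

theorem schaafDenom_eq (hx : 0 < x) :
    schaafDenom β x = 6 * (1 - (β - 1) * x ^ (β - 2)) ^ 2
      + 2 * (β - 1) * (β - 2) * x ^ (β - 2) * (1 - x ^ (β - 2)) := by
  unfold schaafDenom
  rw [oscForce_eq hx, oscForce₂_eq hx, oscForce₁]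
  field_simp
  ring

theorem schaafExpr_eq (hx : 0 < x) :
    schaafExpr β x = (β - 1) * (β - 2) * (x ^ (β - 2) / x ^ 2)
      * (3 * (β - 3) + (β - 1) * (2 * β - 1) * x ^ (β - 2)) := by
  unfold schaafExpr
  rw [oscForce₃_eq hx, oscForce₂_eq hx, oscForce₁]
  field_simp
  ring

/-- `E'' > 0` means `(β-1)t < 1` for `t = x^(β-2)`, so the last factor of `schaafExpr_eq` is below
`3(β-3) + (2β-1) = 5(β-2) < 0`. -/
theorem schaafExpr_pos (hβ1 : 1 < β) (hβ : β < 2) (hx : 0 < x) (h1 : 0 < oscForce₁ β x) :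
    0 < schaafExpr β x := by
  rw [schaafExpr_eq hx]
  have ht : 0 < x ^ (β - 2) := Real.rpow_pos_of_pos hx _
  unfold oscForce₁ at h1
  set t := x ^ (β - 2)
  have hb : 3 * (β - 3) + (β - 1) * (2 * β - 1) * t < 0 := by nlinarith
  have h2 : (β - 1) * (β - 2) < 0 := by nlinarith
  have h3 : 0 < t / x ^ 2 := by positivity
  exact mul_pos_of_neg_of_neg (mul_neg_of_neg_of_pos h2 h3) hb

/-- The threshold `1/2` enters here: `(β-1)(2β-1)` is negative, so the last factor of
`schaafExpr_eq` is negative for every `t`. -/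
theorem schaafExpr_neg (hβ2 : 1 / 2 < β) (hβ : β < 1) (hx : 0 < x) : schaafExpr β x < 0 := by
  rw [schaafExpr_eq hx]
  have ht : 0 < x ^ (β - 2) := Real.rpow_pos_of_pos hx _
  set t := x ^ (β - 2)
  have hb : 3 * (β - 3) + (β - 1) * (2 * β - 1) * t < 0 := by
    have : 0 < (1 - β) * (2 * β - 1) * t :=
      mul_pos (mul_pos (by linarith) (by linarith)) ht
    nlinarith
  have h2 : 0 < (β - 1) * (β - 2) := by nlinarith
  have h3 : 0 < t / x ^ 2 := by positivity
  exact mul_neg_of_pos_of_neg (mul_pos h2 h3) hb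

theorem rpow_sub_two_le (hβ : β < 2) {y : ℝ} (hx : 0 < x) (hxy : x ≤ y) :
    y ^ (β - 2) ≤ x ^ (β - 2) :=
  Real.rpow_le_rpow_of_nonpos hx hxy (by linarith)

/-- With `p = β-1`, the second term of `schaafDenom_eq` is nonnegative for `t ≥ 1`. For `t < 1` its
absolute value is at most `2(1-pt)²`, against the first term `6(1-pt)²`. -/
theorem schaafDenom_pos (hβ1 : 1 < β) (hβ : β < 2) (hx : 0 < x) (h1 : 0 < oscForce₁ β x) :
    0 < schaafDenom β x := by
  rw [schaafDenom_eq hx]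
  have ht : 0 < x ^ (β - 2) := Real.rpow_pos_of_pos hx _
  unfold oscForce₁ at h1
  set t := x ^ (β - 2)
  set p := β - 1
  have hp : β - 2 = p - 1 := by simp only [p]; ring
  have hp0 : 0 < p := by simp only [p]; linarith
  have hp1 : p < 1 := by simp only [p]; linarith
  rw [hp]
  rcases le_or_gt 1 t with h | h
  · have : 0 ≤ (1 - p) * (t - 1) := mul_nonneg (by linarith) (by linarith)
    have := mul_nonneg (mul_pos hp0 ht).le this
    nlinarith [mul_pos h1 h1]
  · have ha : 1 - t ≤ 1 - p * t := by nlinarith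
    have hb : p * t * (1 - p) ≤ 1 - p * t := by nlinarith
    have := mul_le_mul hb ha (by linarith) h1.le
    nlinarith [mul_pos h1 h1]

/-- Chicone's expression is positive for `1 < β < 2`. -/
theorem chiconeExpr_pos (hβ1 : 1 < β) (hβ : β < 2) (hx : 0 < x) (hx1 : x ≠ 1) :
    0 < chiconeExpr β x := by
  have hβ0 : β ≠ 0 := by linarith
  have hE := oscExcess_pos hβ0 hβ hx hx1
  have h1mono : ∀ y, x ≤ y → 0 < oscForce₁ β x → 0 < oscForce₁ β y := by
    intro y hy h
    have := rpow_sub_two_le hβ hx hy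
    unfold oscForce₁ at h ⊢
    nlinarith
  have h1big : ∀ y, 1 ≤ y → 0 < oscForce₁ β y := by
    intro y hy
    have := rpow_sub_two_le hβ one_pos hy
    rw [Real.one_rpow] at this
    unfold oscForce₁
    nlinarith
  rcases lt_or_gt_of_ne hx1 with h | h
  -- Schaaf's criterion needs `E'' > 0`. Where `E'' ≤ 0`, which occurs only left of the minimum, no
  -- term of `chiconeExpr` is negative and the last is positive, because `E' < 0 < E'''`.
  · rcases le_or_gt (oscForce₁ β x) 0 with h1 | h1
    · have hf := oscForce_neg hβ hx h
      have hf2 : 0 < oscForce₂ β x := by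
        unfold oscForce₂
        exact mul_pos (by nlinarith) (Real.rpow_pos_of_pos hx _)
      have := mul_pos hE (mul_pos_of_neg_of_neg hf (neg_neg_of_pos hf2))
      unfold chiconeExpr
      nlinarith [mul_nonneg hE.le (sq_nonneg (oscForce₁ β x)),
        mul_nonneg (sq_nonneg (oscForce β x)) (neg_nonneg.2 h1)]
    · have hD : ∀ y ∈ Icc x 1, 0 < schaafDenom β y := fun y hy =>
        schaafDenom_pos hβ1 hβ (hx.trans_le hy.1) (h1mono y hy.1 h1)
      have := sign_mul_schaafAux_left 1 hβ0 hβ hx h hD fun y hy => by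
        rw [one_mul]
        exact schaafExpr_pos hβ1 hβ (hx.trans hy.1) (h1mono y hy.1.le h1)
      have hDx := hD x ⟨le_rfl, h.le⟩
      rw [chiconeExpr_eq hDx.ne']
      exact mul_pos hDx (by linarith)
  · have hD : ∀ y ∈ Icc 1 x, 0 < schaafDenom β y := fun y hy =>
      schaafDenom_pos hβ1 hβ (zero_lt_one.trans_le hy.1) (h1big y hy.1)
    have := sign_mul_schaafAux_right 1 hβ0 hβ h hD fun y hy => by
      rw [one_mul]
      exact schaafExpr_pos hβ1 hβ (zero_lt_one.trans hy.1) (h1big y hy.1.le)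
    have hDx := hD x ⟨h.le, le_rfl⟩
    rw [chiconeExpr_eq hDx.ne']
    exact mul_pos hDx (by linarith)

/-- As a quadratic in `t`, the denominator has constant term `6` and leading coefficient `2p(2p+1) <
0`, so its quotient by `t` decreases in `t`. Since `t = x^(β-2)` decreases in `x`, positivity
propagates to the right; `key` is this comparison with fractions cleared. -/
theorem schaafDenom_pos_of_ge (hβ2 : 1 / 2 < β) (hβ : β < 1) {y : ℝ} (hx : 0 < x)
    (hxy : x ≤ y) (hD : 0 < schaafDenom β x) : 0 < schaafDenom β y := by
  have ht := rpow_sub_two_le (by linarith : β < 2) hx hxy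
  rw [schaafDenom_eq hx] at hD
  rw [schaafDenom_eq (hx.trans_le hxy)]
  have hu : 0 < y ^ (β - 2) := Real.rpow_pos_of_pos (hx.trans_le hxy) _
  set t := x ^ (β - 2)
  set u := y ^ (β - 2)
  set p := β - 1
  have hp : β - 2 = p - 1 := by simp only [p]; ring
  have hp0 : p < 0 := by simp only [p]; linarith
  have hp1 : 0 < 2 * p + 1 := by simp only [p]; linarith
  rw [hp] at hD ⊢
  have hpp : 0 < -(2 * p) * (2 * p + 1) := mul_pos (by linarith) hp1
  have key : t * (6 * (1 - p * u) ^ 2 + 2 * p * (p - 1) * u * (1 - u))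
      = u * (6 * (1 - p * t) ^ 2 + 2 * p * (p - 1) * t * (1 - t))
        + (t - u) * (6 + (-(2 * p) * (2 * p + 1)) * (t * u)) := by ring
  have htp : 0 < t := hu.trans_le ht
  refine pos_of_mul_pos_right (a := t) ?_ htp.le
  rw [key]
  have h1 := mul_pos hu hD
  have h2 : 0 ≤ (t - u) * (6 + (-(2 * p) * (2 * p + 1)) * (t * u)) :=
    mul_nonneg (by linarith) (by positivity)
  linarith

/-- Chicone's expression is negative for `1/2 < β < 1`. -/
theorem chiconeExpr_neg (hβ2 : 1 / 2 < β) (hβ : β < 1) (hx : 0 < x) (hx1 : x ≠ 1) :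
    chiconeExpr β x < 0 := by
  have hβ0 : β ≠ 0 := by linarith
  have hβ' : β < 2 := by linarith
  have hE := oscExcess_pos hβ0 hβ' hx hx1
  have h1 : 0 < oscForce₁ β x := by
    have : 0 < x ^ (β - 2) := Real.rpow_pos_of_pos hx _
    unfold oscForce₁
    nlinarith
  -- If the denominator is not positive, `E * schaafDenom - 3E'²E''` is negative outright. Otherwise
  -- the denominator is positive all the way between `x` and `1`, and Schaaf's criterion applies.
  rcases le_or_gt (schaafDenom β x) 0 with hD | hD
  · have hf : 0 < oscForce β x ^ 2 := by
      have := oscForce_ne_zero hβ' hx hx1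
      positivity
    have : chiconeExpr β x
        = oscExcess β x * schaafDenom β x - 3 * (oscForce β x ^ 2 * oscForce₁ β x) := by
      unfold chiconeExpr schaafDenom
      ring
    rw [this]
    nlinarith [mul_pos hf h1, mul_nonneg hE.le (neg_nonneg.2 hD)]
  · rw [chiconeExpr_eq hD.ne']
    apply mul_neg_of_pos_of_neg hD
    have hD1 : 0 < schaafDenom β 1 := by
      rw [schaafDenom_eq one_pos, Real.one_rpow]
      nlinarith
    rcases lt_or_gt_of_ne hx1 with h | h
    · have := sign_mul_schaafAux_left (-1) hβ0 hβ' hx h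
        (fun y hy => schaafDenom_pos_of_ge hβ2 hβ hx hy.1 hD) fun y hy => by
          have := schaafExpr_neg hβ2 hβ (hx.trans hy.1)
          linarith
      linarith
    · have := sign_mul_schaafAux_right (-1) hβ0 hβ' h
        (fun y hy => schaafDenom_pos_of_ge hβ2 hβ one_pos hy.1 hD1) fun y hy => by
          have := schaafExpr_neg hβ2 hβ (zero_lt_one.trans hy.1)
          linarith
      linarith

end

/-! ### The ratio `E/E'²`, its derivative across the minimum, and the quadratic coordinate. -/

section

variable {β x : ℝ}

/-- If `g` is the derivative of `f` on a punctured neighborhood of `x`, and both functions are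
continuous at `x`, then `g x` is the derivative of `f` at `x`. -/
theorem hasDerivAt_of_eventually_ne {f g : ℝ → ℝ} {x : ℝ}
    (hd : ∀ᶠ y in 𝓝[≠] x, HasDerivAt f (g y) y) (hf : ContinuousAt f x)
    (hg : ContinuousAt g x) : HasDerivAt f (g x) x := by
  have key : ∀ s : Set ℝ, s ⊆ {x}ᶜ →
      Tendsto (fun y => deriv f y) (𝓝[s] x) (𝓝 (g x)) := fun s hs => by
    refine (hg.tendsto.mono_left nhdsWithin_le_nhds).congr' ?_
    filter_upwards [nhdsWithin_mono x hs hd] with y hy using hy.deriv.symm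
  have hdiff : DifferentiableOn ℝ f {y | HasDerivAt f (g y) y} :=
    fun y hy => hy.differentiableAt.differentiableWithinAt
  have A : HasDerivWithinAt f (g x) (Ici x) x :=
    hasDerivWithinAt_Ici_of_tendsto_deriv hdiff hf.continuousWithinAt
      (nhdsWithin_mono x (fun y (hy : x < y) => hy.ne') hd)
      (key _ fun y (hy : x < y) => hy.ne')
  have B : HasDerivWithinAt f (g x) (Iic x) x :=
    hasDerivWithinAt_Iic_of_tendsto_deriv hdiff hf.continuousWithinAt
      (nhdsWithin_mono x (fun y (hy : y < x) => hy.ne) hd)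
      (key _ fun y (hy : y < x) => hy.ne)
  simpa using B.union A

/-- The quotient `E / E'²` of the oscillator potential, extended continuously to `x = 1`. -/
def oscRatio (β x : ℝ) : ℝ :=
  if x = 1 then 1 / (2 * (2 - β)) else oscExcess β x / oscForce β x ^ 2

/-- The derivative of `oscRatio`. -/
def oscRatio₁ (β x : ℝ) : ℝ :=
  if x = 1 then (1 - β) / (3 * (2 - β)) else
    (oscForce β x ^ 2 - 2 * oscExcess β x * oscForce₁ β x) / oscForce β x ^ 3

theorem oscForce₁_one : oscForce₁ β 1 = 2 - β := by
  simp only [oscForce₁, Real.one_rpow]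
  ring

theorem eventually_pos_ne_one : ∀ᶠ y : ℝ in 𝓝[≠] 1, 0 < y ∧ y ≠ 1 :=
  Filter.Eventually.and (nhdsWithin_le_nhds (Ioi_mem_nhds one_pos)) self_mem_nhdsWithin

theorem eventually_oscForce₁_ne_zero (hβ : β < 2) : ∀ᶠ y in 𝓝[≠] 1, oscForce₁ β y ≠ 0 := by
  apply nhdsWithin_le_nhds
  apply (hasDerivAt_oscForce₁ (β := β) one_pos).continuousAt.eventually_ne
  rw [oscForce₁_one]
  linarith

theorem tendsto_oscExcess_div (hβ0 : β ≠ 0) (hβ : β < 2) :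
    Tendsto (fun y => oscExcess β y / oscForce β y ^ 2) (𝓝[≠] 1) (𝓝 (1 / (2 * (2 - β)))) := by
  have hE := (hasDerivAt_oscExcess hβ0 one_pos).continuousAt.tendsto.mono_left
    (nhdsWithin_le_nhds (s := {1}ᶜ))
  have hf := (hasDerivAt_oscForce (β := β) one_pos).continuousAt.tendsto.mono_left
    (nhdsWithin_le_nhds (s := {1}ᶜ))
  have hf1 := (hasDerivAt_oscForce₁ (β := β) one_pos).continuousAt.tendsto.mono_left
    (nhdsWithin_le_nhds (s := {1}ᶜ))
  rw [oscExcess_one] at hE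
  rw [oscForce_one] at hf
  rw [oscForce₁_one] at hf1
  apply HasDerivAt.lhopital_zero_nhdsNE (f' := oscForce β)
    (g' := fun y => 2 * oscForce β y * oscForce₁ β y)
  · filter_upwards [eventually_pos_ne_one] with y hy using hasDerivAt_oscExcess hβ0 hy.1
  · filter_upwards [eventually_pos_ne_one] with y hy
    exact ((hasDerivAt_oscForce hy.1).pow 2).congr_deriv (by norm_num)
  · filter_upwards [eventually_pos_ne_one, eventually_oscForce₁_ne_zero hβ] with y hy h1
    exact mul_ne_zero (mul_ne_zero two_ne_zero (oscForce_ne_zero hβ hy.1 hy.2)) h1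
  · exact hE
  · simpa using hf.pow 2
  · have : Tendsto (fun y => 1 / (2 * oscForce₁ β y)) (𝓝[≠] 1) (𝓝 (1 / (2 * (2 - β)))) :=
      tendsto_const_nhds.div (hf1.const_mul 2) (by linarith)
    refine this.congr' ?_
    filter_upwards [eventually_pos_ne_one, eventually_oscForce₁_ne_zero hβ] with y hy h1
    have := oscForce_ne_zero hβ hy.1 hy.2
    field_simp

/-- In the derivative of the numerator the terms `E'E''` cancel and leave `-2EE'''`, so one use of
l'Hôpital's rule reduces the limit to that of `E/E'²`. -/
theorem tendsto_oscRatio₁ (hβ0 : β ≠ 0) (hβ : β < 2) :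
    Tendsto (fun y => (oscForce β y ^ 2 - 2 * oscExcess β y * oscForce₁ β y) / oscForce β y ^ 3)
      (𝓝[≠] 1) (𝓝 ((1 - β) / (3 * (2 - β)))) := by
  have hE := (hasDerivAt_oscExcess hβ0 one_pos).continuousAt.tendsto.mono_left
    (nhdsWithin_le_nhds (s := {1}ᶜ))
  have hf := (hasDerivAt_oscForce (β := β) one_pos).continuousAt.tendsto.mono_left
    (nhdsWithin_le_nhds (s := {1}ᶜ))
  have hf1 := (hasDerivAt_oscForce₁ (β := β) one_pos).continuousAt.tendsto.mono_left
    (nhdsWithin_le_nhds (s := {1}ᶜ))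
  have hf2 := (hasDerivAt_oscForce₂ (β := β) one_pos).continuousAt.tendsto.mono_left
    (nhdsWithin_le_nhds (s := {1}ᶜ))
  rw [oscExcess_one] at hE
  rw [oscForce_one] at hf
  rw [oscForce₁_one] at hf1
  apply HasDerivAt.lhopital_zero_nhdsNE (f' := fun y => -2 * oscExcess β y * oscForce₂ β y)
    (g' := fun y => 3 * oscForce β y ^ 2 * oscForce₁ β y)
  · filter_upwards [eventually_pos_ne_one] with y hy
    refine (((hasDerivAt_oscForce hy.1).pow 2).sub
      (((hasDerivAt_oscExcess hβ0 hy.1).const_mul 2).mul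
        (hasDerivAt_oscForce₁ hy.1))).congr_deriv ?_
    push_cast
    ring
  · filter_upwards [eventually_pos_ne_one] with y hy
    exact ((hasDerivAt_oscForce hy.1).pow 3).congr_deriv (by norm_num)
  · filter_upwards [eventually_pos_ne_one, eventually_oscForce₁_ne_zero hβ] with y hy h1
    exact mul_ne_zero (mul_ne_zero three_ne_zero
      (pow_ne_zero 2 (oscForce_ne_zero hβ hy.1 hy.2))) h1
  · simpa using (hf.pow 2).sub ((hE.const_mul 2).mul hf1)
  · simpa using hf.pow 3
  · have hne : 3 * (2 - β) ≠ 0 := by linarith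
    have := (tendsto_oscExcess_div hβ0 hβ).mul
      ((hf2.const_mul (-2)).div (hf1.const_mul 3) hne)
    have hval : 1 / (2 * (2 - β)) * (-2 * oscForce₂ β 1 / (3 * (2 - β)))
        = (1 - β) / (3 * (2 - β)) := by
      have : 2 - β ≠ 0 := by linarith
      simp only [oscForce₂, Real.one_rpow]
      field_simp
      ring
    rw [hval] at this
    refine this.congr' ?_
    filter_upwards [eventually_pos_ne_one, eventually_oscForce₁_ne_zero hβ] with y hy h1
    have := oscForce_ne_zero hβ hy.1 hy.2
    simp only [Pi.div_apply]
    field_simp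

theorem continuousAt_oscRatio_one (hβ0 : β ≠ 0) (hβ : β < 2) : ContinuousAt (oscRatio β) 1 := by
  rw [continuousAt_iff_punctured_nhds]
  have : oscRatio β 1 = 1 / (2 * (2 - β)) := if_pos rfl
  rw [this]
  refine (tendsto_oscExcess_div hβ0 hβ).congr' ?_
  filter_upwards [self_mem_nhdsWithin] with y (hy : y ≠ 1) using (if_neg hy).symm

theorem continuousAt_oscRatio₁_one (hβ0 : β ≠ 0) (hβ : β < 2) :
    ContinuousAt (oscRatio₁ β) 1 := by
  rw [continuousAt_iff_punctured_nhds]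
  have : oscRatio₁ β 1 = (1 - β) / (3 * (2 - β)) := if_pos rfl
  rw [this]
  refine (tendsto_oscRatio₁ hβ0 hβ).congr' ?_
  filter_upwards [self_mem_nhdsWithin] with y (hy : y ≠ 1) using (if_neg hy).symm

theorem hasDerivAt_oscRatio_of_ne (hβ0 : β ≠ 0) (hβ : β < 2) (hx : 0 < x) (hx1 : x ≠ 1) :
    HasDerivAt (oscRatio β) (oscRatio₁ β x) x := by
  have hf := oscForce_ne_zero hβ hx hx1
  have h := (hasDerivAt_oscExcess hβ0 hx).div ((hasDerivAt_oscForce (β := β) hx).pow 2)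
    (pow_ne_zero 2 hf)
  have h' : HasDerivAt (oscRatio β) _ x := h.congr_of_eventuallyEq (by
    filter_upwards [isOpen_ne.mem_nhds hx1] with y (hy : y ≠ 1)
    simp [oscRatio, hy])
  refine h'.congr_deriv ?_
  simp only [oscRatio₁, hx1, if_false, Pi.pow_apply]
  field_simp
  norm_num
  ring

theorem hasDerivAt_oscRatio (hβ0 : β ≠ 0) (hβ : β < 2) (hx : 0 < x) :
    HasDerivAt (oscRatio β) (oscRatio₁ β x) x := by
  rcases eq_or_ne x 1 with rfl | hx1
  · refine hasDerivAt_of_eventually_ne ?_ (continuousAt_oscRatio_one hβ0 hβ)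
      (continuousAt_oscRatio₁_one hβ0 hβ)
    filter_upwards [eventually_pos_ne_one] with y hy
      using hasDerivAt_oscRatio_of_ne hβ0 hβ hy.1 hy.2
  · exact hasDerivAt_oscRatio_of_ne hβ0 hβ hx hx1

theorem hasDerivAt_oscRatio₁ (hβ0 : β ≠ 0) (hβ : β < 2) (hx : 0 < x) (hx1 : x ≠ 1) :
    HasDerivAt (oscRatio₁ β) (chiconeExpr β x / oscForce β x ^ 4) x := by
  have hf := oscForce_ne_zero hβ hx hx1
  have hF := hasDerivAt_oscForce (β := β) hx
  have h := ((hF.pow 2).sub (((hasDerivAt_oscExcess hβ0 hx).const_mul 2).mul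
    (hasDerivAt_oscForce₁ (β := β) hx))).div (hF.pow 3) (pow_ne_zero 3 hf)
  have h' : HasDerivAt (oscRatio₁ β) _ x := h.congr_of_eventuallyEq (by
    filter_upwards [isOpen_ne.mem_nhds hx1] with y (hy : y ≠ 1)
    simp [oscRatio₁, hy])
  refine h'.congr_deriv ?_
  simp only [chiconeExpr, Pi.pow_apply, Pi.sub_apply, Pi.mul_apply]
  field_simp
  norm_num
  ring

theorem continuousOn_oscRatio₁ (hβ0 : β ≠ 0) (hβ : β < 2) :
    ContinuousOn (oscRatio₁ β) (Ioi 0) := by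
  intro y hy
  apply ContinuousAt.continuousWithinAt
  rcases eq_or_ne y 1 with rfl | hy1
  · exact continuousAt_oscRatio₁_one hβ0 hβ
  · exact (hasDerivAt_oscRatio₁ hβ0 hβ hy hy1).continuousAt

theorem oscRatio_pos (hβ0 : β ≠ 0) (hβ : β < 2) (hx : 0 < x) : 0 < oscRatio β x := by
  unfold oscRatio
  split_ifs with h
  · have : 0 < 2 - β := by linarith
    positivity
  · have := oscExcess_pos hβ0 hβ hx h
    have := oscForce_ne_zero hβ hx h
    positivity

theorem strictMonoOn_oscRatio₁ (hβ1 : 1 < β) (hβ : β < 2) :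
    StrictMonoOn (oscRatio₁ β) (Ioi 0) := by
  have hβ0 : β ≠ 0 := by linarith
  have hc := continuousOn_oscRatio₁ hβ0 hβ
  have hd : ∀ y, 0 < y → y ≠ 1 → 0 < deriv (oscRatio₁ β) y := fun y hy hy1 => by
    rw [(hasDerivAt_oscRatio₁ hβ0 hβ hy hy1).deriv]
    have := chiconeExpr_pos hβ1 hβ hy hy1
    have := oscForce_ne_zero hβ hy hy1
    positivity
  -- The formula for `R''` is available only off `x = 1`; strict monotonicity on the two closed
  -- sides is glued there by continuity.
  rw [← Ioc_union_Ici_eq_Ioi (zero_lt_one (α := ℝ))]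
  refine StrictMonoOn.union (c := 1) ?_ ?_ (isGreatest_Ioc one_pos) isLeast_Ici
  · refine strictMonoOn_of_deriv_pos (convex_Ioc _ _) (hc.mono fun y hy => hy.1) fun y hy => ?_
    rw [interior_Ioc] at hy
    exact hd y hy.1 hy.2.ne
  · refine strictMonoOn_of_deriv_pos (convex_Ici _)
      (hc.mono fun y hy => mem_Ioi.2 (zero_lt_one.trans_le hy)) fun y hy => ?_
    rw [interior_Ici] at hy
    exact hd y (zero_lt_one.trans hy) (ne_of_gt hy)

theorem strictAntiOn_oscRatio₁ (hβ2 : 1 / 2 < β) (hβ : β < 1) :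
    StrictAntiOn (oscRatio₁ β) (Ioi 0) := by
  have hβ0 : β ≠ 0 := by linarith
  have hβ' : β < 2 := by linarith
  have hc := continuousOn_oscRatio₁ hβ0 hβ'
  have hd : ∀ y, 0 < y → y ≠ 1 → deriv (oscRatio₁ β) y < 0 := fun y hy hy1 => by
    rw [(hasDerivAt_oscRatio₁ hβ0 hβ' hy hy1).deriv]
    have := chiconeExpr_neg hβ2 hβ hy hy1
    have := oscForce_ne_zero hβ' hy hy1
    exact div_neg_of_neg_of_pos ‹_› (by positivity)
  rw [← Ioc_union_Ici_eq_Ioi (zero_lt_one (α := ℝ))]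
  refine StrictAntiOn.union (c := 1) ?_ ?_ (isGreatest_Ioc one_pos) isLeast_Ici
  · refine strictAntiOn_of_deriv_neg (convex_Ioc _ _) (hc.mono fun y hy => hy.1) fun y hy => ?_
    rw [interior_Ioc] at hy
    exact hd y hy.1 hy.2.ne
  · refine strictAntiOn_of_deriv_neg (convex_Ici _)
      (hc.mono fun y hy => mem_Ioi.2 (zero_lt_one.trans_le hy)) fun y hy => ?_
    rw [interior_Ici] at hy
    exact hd y (zero_lt_one.trans hy) (ne_of_gt hy)

/-- For `β = 1` the excess is `(x-1)²/2`: the oscillator is harmonic and `R` is constant. These are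
the Kepler problem `α = 1` and its dual `α = -2`. -/
theorem oscRatio₁_one_left : oscRatio₁ 1 x = 0 := by
  unfold oscRatio₁
  split_ifs with h
  · norm_num
  · have : oscForce 1 x ^ 2 - 2 * oscExcess 1 x * oscForce₁ 1 x = 0 := by
      simp [oscForce, oscExcess, oscPotential, oscForce₁]
      ring
    rw [this, zero_div]

/-- The coordinate `±√(2E)` in which the oscillator potential is quadratic. -/
def oscCoord (β x : ℝ) : ℝ := if 1 ≤ x then √(2 * oscExcess β x) else -√(2 * oscExcess β x)

theorem oscExcess_nonneg (hβ0 : β ≠ 0) (hβ : β < 2) (hx : 0 < x) : 0 ≤ oscExcess β x := by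
  rcases eq_or_ne x 1 with rfl | h
  · exact oscExcess_one.ge
  · exact (oscExcess_pos hβ0 hβ hx h).le

theorem oscCoord_sq (hβ0 : β ≠ 0) (hβ : β < 2) (hx : 0 < x) :
    oscCoord β x ^ 2 = 2 * oscExcess β x := by
  have := oscExcess_nonneg hβ0 hβ hx
  unfold oscCoord
  split_ifs
  · exact Real.sq_sqrt (by linarith)
  · rw [neg_sq]; exact Real.sq_sqrt (by linarith)

theorem strictMonoOn_oscCoord (hβ0 : β ≠ 0) (hβ : β < 2) :
    StrictMonoOn (oscCoord β) (Ioi 0) := by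
  rw [← Ioc_union_Ici_eq_Ioi (zero_lt_one (α := ℝ))]
  have hle : ∀ y ∈ Ioc (0 : ℝ) 1, oscCoord β y = -√(2 * oscExcess β y) := by
    intro y hy
    rcases eq_or_lt_of_le hy.2 with h | h
    · subst h
      simp [oscCoord, oscExcess_one]
    · exact if_neg (not_le.2 h)
  refine StrictMonoOn.union (c := 1) ?_ ?_ (isGreatest_Ioc one_pos) isLeast_Ici
  · intro y hy z hz hyz
    rw [hle y hy, hle z hz]
    have := strictAntiOn_oscExcess hβ0 hβ hy hz hyz
    have := oscExcess_nonneg hβ0 hβ hz.1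
    exact neg_lt_neg (Real.sqrt_lt_sqrt (by linarith) (by linarith))
  · intro y hy z hz hyz
    have := strictMonoOn_oscExcess hβ0 hβ hy hz hyz
    have := oscExcess_nonneg hβ0 hβ (zero_lt_one.trans_le hy)
    simp only [oscCoord, if_pos (mem_Ici.1 hy), if_pos (mem_Ici.1 hz)]
    exact Real.sqrt_lt_sqrt (by linarith) (by linarith)

theorem continuousAt_oscCoord_one (hβ0 : β ≠ 0) : ContinuousAt (oscCoord β) 1 := by
  have h1 : oscCoord β 1 = 0 := by simp [oscCoord, oscExcess_one]
  have hE : Tendsto (fun y => √(2 * oscExcess β y)) (𝓝 1) (𝓝 0) := by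
    have := ((hasDerivAt_oscExcess hβ0 one_pos).continuousAt.const_mul 2).sqrt.tendsto
    simpa [oscExcess_one] using this
  rw [ContinuousAt, h1]
  refine squeeze_zero_norm (fun y => ?_) hE
  unfold oscCoord
  split_ifs
  · rw [Real.norm_of_nonneg (Real.sqrt_nonneg _)]
  · rw [norm_neg, Real.norm_of_nonneg (Real.sqrt_nonneg _)]

/-- The derivative is `|E'|/√(2E)`; the sign chosen in `oscCoord` supplies the absolute value.
Written through `R`, it extends continuously over the minimum. -/
theorem hasDerivAt_oscCoord_of_ne (hβ0 : β ≠ 0) (hβ : β < 2) (hx : 0 < x) (hx1 : x ≠ 1) :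
    HasDerivAt (oscCoord β) (√(2 * oscRatio β x))⁻¹ x := by
  have hE := oscExcess_pos hβ0 hβ hx hx1
  have h := ((hasDerivAt_oscExcess hβ0 hx).const_mul 2).sqrt (by linarith)
  have hR : √(2 * oscRatio β x) = √(2 * oscExcess β x) / |oscForce β x| := by
    rw [oscRatio, if_neg hx1, ← mul_div_assoc, Real.sqrt_div (by linarith), Real.sqrt_sq_eq_abs]
  have hs : 0 < √(2 * oscExcess β x) := Real.sqrt_pos.2 (by linarith)
  rw [hR, inv_div]
  rcases lt_or_gt_of_ne hx1 with hlt | hgt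
  · refine (h.neg.congr_of_eventuallyEq ?_).congr_deriv ?_
    · filter_upwards [Iio_mem_nhds hlt] with y hy
      simp [oscCoord, not_le.2 (mem_Iio.1 hy)]
    · rw [abs_of_neg (oscForce_neg hβ hx hlt)]
      field_simp
  · refine (h.congr_of_eventuallyEq ?_).congr_deriv ?_
    · filter_upwards [Ioi_mem_nhds hgt] with y hy
      simp [oscCoord, (mem_Ioi.1 hy).le]
    · rw [abs_of_pos (oscForce_pos hβ hgt)]
      field_simp

theorem hasDerivAt_oscCoord (hβ0 : β ≠ 0) (hβ : β < 2) (hx : 0 < x) :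
    HasDerivAt (oscCoord β) (√(2 * oscRatio β x))⁻¹ x := by
  rcases eq_or_ne x 1 with rfl | hx1
  · refine hasDerivAt_of_eventually_ne (g := fun y => (√(2 * oscRatio β y))⁻¹) ?_
      (continuousAt_oscCoord_one hβ0) ?_
    · filter_upwards [eventually_pos_ne_one] with y hy
        using hasDerivAt_oscCoord_of_ne hβ0 hβ hy.1 hy.2
    · refine ((continuousAt_oscRatio_one hβ0 hβ).const_mul 2).sqrt.inv₀ ?_
      have := oscRatio_pos hβ0 hβ one_pos
      positivity
  · exact hasDerivAt_oscCoord_of_ne hβ0 hβ hx hx1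

theorem oscExcess_zero (hβ0 : β ≠ 0) : oscExcess β 0 = (2 / β - 1) / 2 := by
  simp [oscExcess, oscPotential, Real.zero_rpow hβ0]
  ring

/-- The bound `2/β - 1` is twice the depth of the well, that is `2E(0)`, so the values allowed
correspond to negative oscillator energy. -/
theorem exists_oscCoord_eq (hβ0 : 0 < β) (hβ : β < 2) {y : ℝ} (hy : y ^ 2 < 2 / β - 1) :
    ∃ x, 0 < x ∧ oscCoord β x = y := by
  have hcont : Continuous (oscExcess β) := by
    unfold oscExcess oscPotential
    have := Real.continuous_rpow_const (q := β) hβ0.le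
    fun_prop
  rcases le_or_gt 0 y with h | h
  -- `z` is the positive zero of `U`, where the excess equals that at `x = 0`.
  · set z := (2 / β) ^ (1 / (2 - β)) with hz
    have h2 : 1 < 2 / β := by rw [lt_div_iff₀ hβ0]; linarith
    have hz1 : 1 < z := Real.one_lt_rpow h2 (by have : 0 < 2 - β := by linarith
                                                positivity)
    have hz0 : 0 < z := one_pos.trans hz1
    have hzpow : z ^ 2 = (2 / β) * z ^ β := by
      have h1 : z ^ (2 - β) = 2 / β := by
        rw [hz, ← Real.rpow_mul (by positivity), one_div, inv_mul_cancel₀ (by linarith),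
          Real.rpow_one]
      rw [← h1, ← Real.rpow_add hz0, sub_add_cancel, Real.rpow_two]
    have hEz : oscExcess β z = (2 / β - 1) / 2 := by
      simp only [oscExcess, oscPotential, hzpow, Real.one_rpow]
      ring
    obtain ⟨x, hx, hxe⟩ := intermediate_value_Icc hz1.le hcont.continuousOn
      (show y ^ 2 / 2 ∈ Icc (oscExcess β 1) (oscExcess β z) by
        rw [oscExcess_one, hEz]
        exact ⟨by positivity, by linarith⟩)
    refine ⟨x, one_pos.trans_le hx.1, ?_⟩
    rw [oscCoord, if_pos hx.1, hxe, mul_div_cancel₀ _ two_ne_zero, Real.sqrt_sq h]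
  · obtain ⟨x, hx, hxe⟩ := intermediate_value_Icc' zero_le_one hcont.continuousOn
      (show y ^ 2 / 2 ∈ Icc (oscExcess β 1) (oscExcess β 0) by
        rw [oscExcess_one, oscExcess_zero hβ0.ne']
        exact ⟨by positivity, by linarith⟩)
    have hx0 : x ≠ 0 := by
      rintro rfl
      rw [oscExcess_zero hβ0.ne'] at hxe
      linarith
    have hx1 : x ≠ 1 := by
      rintro rfl
      rw [oscExcess_one] at hxe
      have := pow_pos (neg_pos.2 h) 2
      rw [neg_sq] at this
      linarith
    refine ⟨x, lt_of_le_of_ne hx.1 hx0.symm, ?_⟩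
    rw [oscCoord, if_neg (not_le.2 (lt_of_le_of_ne hx.2 hx1)), hxe,
      mul_div_cancel₀ _ two_ne_zero, Real.sqrt_sq_eq_abs, abs_of_neg h, neg_neg]

/-- The inverse of `oscCoord`. -/
def oscInv (β : ℝ) : ℝ → ℝ := Function.invFunOn (oscCoord β) (Ioi 0)

theorem oscInv_pos (hβ0 : 0 < β) (hβ : β < 2) {y : ℝ} (hy : y ^ 2 < 2 / β - 1) :
    0 < oscInv β y :=
  Function.invFunOn_mem (exists_oscCoord_eq hβ0 hβ hy)

theorem oscCoord_oscInv (hβ0 : 0 < β) (hβ : β < 2) {y : ℝ} (hy : y ^ 2 < 2 / β - 1) :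
    oscCoord β (oscInv β y) = y :=
  Function.invFunOn_eq (exists_oscCoord_eq hβ0 hβ hy)

theorem oscInv_oscCoord (hβ0 : β ≠ 0) (hβ : β < 2) (hx : 0 < x) :
    oscInv β (oscCoord β x) = x :=
  (strictMonoOn_oscCoord hβ0 hβ).injOn.leftInvOn_invFunOn hx

theorem oscExcess_oscInv (hβ0 : 0 < β) (hβ : β < 2) {y : ℝ} (hy : y ^ 2 < 2 / β - 1) :
    oscExcess β (oscInv β y) = y ^ 2 / 2 := by
  have := oscCoord_sq hβ0.ne' hβ (oscInv_pos hβ0 hβ hy)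
  rw [oscCoord_oscInv hβ0 hβ hy] at this
  linarith

/-- The derivative of `oscInv`. -/
def oscSpeed (β y : ℝ) : ℝ := √(2 * oscRatio β (oscInv β y))

theorem oscSpeed_pos (hβ0 : 0 < β) (hβ : β < 2) {y : ℝ} (hy : y ^ 2 < 2 / β - 1) :
    0 < oscSpeed β y := by
  have := oscRatio_pos hβ0.ne' hβ (oscInv_pos hβ0 hβ hy)
  unfold oscSpeed
  positivity

theorem hasDerivAt_oscInv (hβ0 : 0 < β) (hβ : β < 2) {y : ℝ} (hy : y ^ 2 < 2 / β - 1) :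
    HasDerivAt (oscInv β) (oscSpeed β y) y := by
  have hx := oscInv_pos hβ0 hβ hy
  have h := (hasDerivAt_leftInverse isOpen_Ioi (strictMonoOn_oscCoord hβ0.ne' hβ)
    (fun x hx => hasDerivAt_oscCoord hβ0.ne' hβ hx)
    (fun x hx => oscInv_oscCoord hβ0.ne' hβ hx) hx
    (by have := oscRatio_pos hβ0.ne' hβ hx
        positivity)).2
  rw [oscCoord_oscInv hβ0 hβ hy, inv_inv] at h
  exact h

/-- The factor `√(2R)` from the chain rule through `oscInv` cancels the one from differentiating the
square root, leaving exactly `R'`. -/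
theorem hasDerivAt_oscSpeed (hβ0 : 0 < β) (hβ : β < 2) {y : ℝ} (hy : y ^ 2 < 2 / β - 1) :
    HasDerivAt (oscSpeed β) (oscRatio₁ β (oscInv β y)) y := by
  have hx := oscInv_pos hβ0 hβ hy
  have hR := oscRatio_pos hβ0.ne' hβ hx
  have h := (((hasDerivAt_oscRatio hβ0.ne' hβ hx).comp y
    (hasDerivAt_oscInv hβ0 hβ hy)).const_mul 2).sqrt (by simp only [Function.comp]; positivity)
  refine h.congr_deriv ?_
  have hs : 0 < √(2 * oscRatio β (oscInv β y)) := Real.sqrt_pos.2 (by positivity)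
  simp only [oscSpeed, Function.comp]
  field_simp

theorem strictMonoOn_oscInv (hβ0 : 0 < β) (hβ : β < 2) :
    StrictMonoOn (oscInv β) {y | y ^ 2 < 2 / β - 1} := by
  intro y hy z hz hyz
  rw [← (strictMonoOn_oscCoord hβ0.ne' hβ).lt_iff_lt (oscInv_pos hβ0 hβ hy)
    (oscInv_pos hβ0 hβ hz), oscCoord_oscInv hβ0 hβ hy, oscCoord_oscInv hβ0 hβ hz]
  exact hyz

end

/-! ### The half-period and the eccentricity as functions of the amplitude. -/

section

variable {β : ℝ}

/-- The half-period of the oscillator as a function of the amplitude in the coordinate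
`oscCoord`. -/
def oscAngle (β a : ℝ) : ℝ := ∫ θ in (-(Real.pi / 2))..(Real.pi / 2), oscSpeed β (a * Real.sin θ)

theorem mul_sin_sq_le (a θ : ℝ) : (a * Real.sin θ) ^ 2 ≤ a ^ 2 := by
  rw [mul_pow]
  exact mul_le_of_le_one_right (sq_nonneg a) (Real.sin_sq_le_one θ)

theorem continuousOn_oscRatio₁_oscInv (hβ0 : 0 < β) (hβ : β < 2) :
    ContinuousOn (fun y => oscRatio₁ β (oscInv β y)) {y | y ^ 2 < 2 / β - 1} :=
  (continuousOn_oscRatio₁ hβ0.ne' hβ).comp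
    (fun _ hy => (hasDerivAt_oscInv hβ0 hβ hy).continuousAt.continuousWithinAt)
    fun _ hy => oscInv_pos hβ0 hβ hy

theorem continuous_oscSpeed_mul_sin (hβ0 : 0 < β) (hβ : β < 2) {a : ℝ} (ha : a ^ 2 < 2 / β - 1) :
    Continuous fun θ => oscSpeed β (a * Real.sin θ) := by
  refine ContinuousOn.comp_continuous (g := oscSpeed β) (s := {y | y ^ 2 < 2 / β - 1})
    (fun y hy => (hasDerivAt_oscSpeed hβ0 hβ hy).continuousAt.continuousWithinAt)
    (by fun_prop) fun θ => (mul_sin_sq_le a θ).trans_lt ha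

theorem continuous_oscRatio₁_mul_sin (hβ0 : 0 < β) (hβ : β < 2) {a : ℝ}
    (ha : a ^ 2 < 2 / β - 1) :
    Continuous fun θ => oscRatio₁ β (oscInv β (a * Real.sin θ)) :=
  ContinuousOn.comp_continuous (continuousOn_oscRatio₁_oscInv hβ0 hβ)
    (by fun_prop) fun θ => (mul_sin_sq_le a θ).trans_lt ha

theorem hasDerivAt_oscAngle (hβ0 : 0 < β) (hβ : β < 2) {a : ℝ} (ha : a ^ 2 < 2 / β - 1) :
    HasDerivAt (oscAngle β) (∫ θ in (-(Real.pi / 2))..(Real.pi / 2),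
      oscRatio₁ β (oscInv β (a * Real.sin θ)) * Real.sin θ) a := by
  -- An intermediate level `m` keeps all `y sin θ` with `y² < m` in the compact interval `[-√m,
  -- √m]`, on which `R'` has a constant bound that dominates the derivative.
  obtain ⟨m, hm1, hm2⟩ := exists_between ha
  have hs : {y : ℝ | y ^ 2 < m} ∈ 𝓝 a :=
    (isOpen_lt (continuous_pow 2) continuous_const).mem_nhds hm1
  obtain ⟨C, hC⟩ : ∃ C, ∀ y ∈ Icc (-√m) (√m), ‖oscRatio₁ β (oscInv β y)‖ ≤ C := by
    refine isCompact_Icc.exists_bound_of_continuousOn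
      ((continuousOn_oscRatio₁_oscInv hβ0 hβ).mono fun y hy => ?_)
    exact ((Real.sq_le ((sq_nonneg a).trans hm1.le)).2 hy).trans_lt hm2
  refine (intervalIntegral.hasDerivAt_integral_of_dominated_loc_of_deriv_le (bound := fun _ => C)
    (F := fun a θ => oscSpeed β (a * Real.sin θ))
    (F' := fun a θ => oscRatio₁ β (oscInv β (a * Real.sin θ)) * Real.sin θ)
    hs ?_ ?_ ?_ ?_ ?_ ?_).2
  · filter_upwards [hs] with y hy
    exact (continuous_oscSpeed_mul_sin hβ0 hβ (lt_trans hy hm2)).aestronglyMeasurable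
  · exact (continuous_oscSpeed_mul_sin hβ0 hβ ha).intervalIntegrable _ _
  · exact ((continuous_oscRatio₁_mul_sin hβ0 hβ ha).mul
      Real.continuous_sin).aestronglyMeasurable
  · refine Eventually.of_forall fun θ _ y hy => ?_
    rw [norm_mul]
    have h2 := hC (y * Real.sin θ) (abs_le.1 (Real.abs_le_sqrt
      ((mul_sin_sq_le y θ).trans (le_of_lt hy))))
    exact (mul_le_of_le_one_right (norm_nonneg _) (Real.abs_sin_le_one θ)).trans h2
  · exact intervalIntegrable_const
  · refine Eventually.of_forall fun θ _ y hy => ?_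
    have hy' : (y * Real.sin θ) ^ 2 < 2 / β - 1 :=
      (mul_sin_sq_le y θ).trans_lt (lt_trans hy hm2)
    exact HasDerivAt.comp (h₂ := oscSpeed β) y (hasDerivAt_oscSpeed hβ0 hβ hy')
      (hasDerivAt_mul_const _)

/-- Since sine is odd, the integral folds to that of `(g θ - g (-θ)) sin θ` over `[0, π/2]`. -/
theorem integral_mul_sin_pos {g : ℝ → ℝ} (hg : Continuous g)
    (hpos : ∀ θ ∈ Ioo (0 : ℝ) (Real.pi / 2), g (-θ) < g θ) :
    0 < ∫ θ in (-(Real.pi / 2))..(Real.pi / 2), g θ * Real.sin θ := by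
  have hi : ∀ a b, IntervalIntegrable (fun θ => g θ * Real.sin θ) volume a b :=
    fun a b => (hg.mul Real.continuous_sin).intervalIntegrable _ _
  have hi' : ∀ a b, IntervalIntegrable (fun θ => g (-θ) * Real.sin θ) volume a b :=
    fun a b => ((hg.comp continuous_neg).mul Real.continuous_sin).intervalIntegrable _ _
  have h1 : ∫ θ in (-(Real.pi / 2))..0, g θ * Real.sin θ
      = -∫ θ in (0 : ℝ)..(Real.pi / 2), g (-θ) * Real.sin θ := by
    rw [← intervalIntegral.integral_neg]
    have := intervalIntegral.integral_comp_neg (a := 0) (b := Real.pi / 2)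
      (fun θ => g θ * Real.sin θ)
    rw [neg_zero] at this
    rw [← this]
    simp
  rw [← intervalIntegral.integral_add_adjacent_intervals (hi _ 0) (hi 0 _), h1,
    neg_add_eq_sub, ← intervalIntegral.integral_sub (hi _ _) (hi' _ _)]
  refine intervalIntegral.intervalIntegral_pos_of_pos_on ((hi _ _).sub (hi' _ _)) ?_
    (by positivity)
  intro θ hθ
  have := hpos θ hθ
  have hs := Real.sin_pos_of_pos_of_lt_pi hθ.1 (by linarith [hθ.2, Real.pi_pos])
  rw [← sub_mul]
  exact mul_pos (by linarith) hs

theorem oscInv_mul_sin_lt (hβ0 : 0 < β) (hβ : β < 2) {a : ℝ} (ha0 : 0 < a)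
    (ha : a ^ 2 < 2 / β - 1) {θ : ℝ} (hθ : θ ∈ Ioo (0 : ℝ) (Real.pi / 2)) :
    oscInv β (a * Real.sin (-θ)) < oscInv β (a * Real.sin θ) := by
  have hs := Real.sin_pos_of_pos_of_lt_pi hθ.1 (by linarith [hθ.2, Real.pi_pos])
  refine strictMonoOn_oscInv hβ0 hβ ((mul_sin_sq_le a _).trans_lt ha)
    ((mul_sin_sq_le a _).trans_lt ha) ?_
  rw [Real.sin_neg]
  have := mul_pos ha0 hs
  linarith

theorem deriv_oscAngle_pos (hβ1 : 1 < β) (hβ : β < 2) {a : ℝ} (ha0 : 0 < a)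
    (ha : a ^ 2 < 2 / β - 1) : 0 < deriv (oscAngle β) a := by
  have hβ0 : 0 < β := by linarith
  rw [(hasDerivAt_oscAngle hβ0 hβ ha).deriv]
  exact integral_mul_sin_pos (continuous_oscRatio₁_mul_sin hβ0 hβ ha) fun θ hθ =>
    strictMonoOn_oscRatio₁ hβ1 hβ (oscInv_pos hβ0 hβ ((mul_sin_sq_le a _).trans_lt ha))
      (oscInv_pos hβ0 hβ ((mul_sin_sq_le a _).trans_lt ha))
      (oscInv_mul_sin_lt hβ0 hβ ha0 ha hθ)

theorem deriv_oscAngle_neg (hβ2 : 1 / 2 < β) (hβ1 : β < 1) {a : ℝ} (ha0 : 0 < a)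
    (ha : a ^ 2 < 2 / β - 1) : deriv (oscAngle β) a < 0 := by
  have hβ0 : 0 < β := by linarith
  have hβ : β < 2 := by linarith
  rw [(hasDerivAt_oscAngle hβ0 hβ ha).deriv, ← neg_pos, ← intervalIntegral.integral_neg]
  have := integral_mul_sin_pos (continuous_oscRatio₁_mul_sin hβ0 hβ ha).neg fun θ hθ =>
    neg_lt_neg (strictAntiOn_oscRatio₁ hβ2 hβ1
      (oscInv_pos hβ0 hβ ((mul_sin_sq_le a _).trans_lt ha))
      (oscInv_pos hβ0 hβ ((mul_sin_sq_le a _).trans_lt ha))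
      (oscInv_mul_sin_lt hβ0 hβ ha0 ha hθ))
  simpa only [Pi.neg_apply, neg_mul] using this

theorem deriv_oscAngle_one {a : ℝ} (ha : a ^ 2 < 1) : deriv (oscAngle 1) a = 0 := by
  rw [(hasDerivAt_oscAngle one_pos one_lt_two (by linarith)).deriv]
  simp [oscRatio₁_one_left]

/-- The eccentricity as a function of the amplitude of the oscillator. -/
def oscEccentricity (β s a : ℝ) : ℝ :=
  (oscInv β a ^ (1 / s) - oscInv β (-a) ^ (1 / s))
    / (oscInv β a ^ (1 / s) + oscInv β (-a) ^ (1 / s))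

/-- For `(u-v)/(u+v)` the numerator of the derivative is `2(u'v - uv')`. Here `u = x(a)^(1/s)`
increases and `v = x(-a)^(1/s)` decreases with the amplitude. -/
theorem exists_hasDerivAt_oscEccentricity (hβ0 : 0 < β) (hβ : β < 2) {s a : ℝ} (hs : 0 < s)
    (ha : a ^ 2 < 2 / β - 1) :
    ∃ e', 0 < e' ∧ HasDerivAt (oscEccentricity β s) e' a := by
  have ha' : (-a) ^ 2 < 2 / β - 1 := by rwa [neg_sq]
  have hp := oscInv_pos hβ0 hβ ha
  have hm := oscInv_pos hβ0 hβ ha'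
  have hP := oscSpeed_pos hβ0 hβ ha
  have hM := oscSpeed_pos hβ0 hβ ha'
  have dp := (hasDerivAt_oscInv hβ0 hβ ha).rpow_const (p := 1 / s) (Or.inl hp.ne')
  have dm := (((hasDerivAt_oscInv hβ0 hβ ha').comp a (hasDerivAt_neg a))).rpow_const
    (p := 1 / s) (Or.inl hm.ne')
  simp only [Function.comp] at dm
  have hup : 0 < oscInv β a ^ (1 / s) := Real.rpow_pos_of_pos hp _
  have hum : 0 < oscInv β (-a) ^ (1 / s) := Real.rpow_pos_of_pos hm _
  have hvp : 0 < oscInv β a ^ (1 / s - 1) := Real.rpow_pos_of_pos hp _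
  have hvm : 0 < oscInv β (-a) ^ (1 / s - 1) := Real.rpow_pos_of_pos hm _
  refine ⟨_, ?_, (dp.sub dm).div (dp.add dm) (by positivity)⟩
  refine div_pos ?_ (by positivity)
  have e1 : 0 < oscSpeed β a * (1 / s) * oscInv β a ^ (1 / s - 1) := by positivity
  have e2 : 0 < oscSpeed β (-a) * (1 / s) * oscInv β (-a) ^ (1 / s - 1) := by positivity
  simp only [Pi.sub_apply]
  nlinarith [mul_pos e1 hum, mul_pos e2 hup]

end

/-! ### From the radial equation to the oscillator: apsides, eccentricity and apsidal angle. -/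

section

/-- The radius at which the oscillator variable `c * r ^ (-s)` has the value `x`. -/
def radius (s c x : ℝ) : ℝ := (c / x) ^ (1 / s)

variable {α ℓ h β s c κ x r : ℝ}

theorem radius_pos (hc : 0 < c) (hx : 0 < x) : 0 < radius s c x :=
  Real.rpow_pos_of_pos (div_pos hc hx) _

theorem radius_rpow (hs : 0 < s) (hc : 0 < c) (hx : 0 < x) : radius s c x ^ s = c / x := by
  rw [radius, ← Real.rpow_mul (div_pos hc hx).le, one_div_mul_cancel hs.ne', Real.rpow_one]

theorem mul_radius_rpow (hs : 0 < s) (hc : 0 < c) (hx : 0 < x) :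
    c * radius s c x ^ (-s) = x := by
  rw [Real.rpow_neg (radius_pos hc hx).le, radius_rpow hs hc hx]
  field_simp

theorem radius_mul_rpow (hs : 0 < s) (hc : 0 < c) (hr : 0 < r) :
    radius s c (c * r ^ (-s)) = r := by
  have : c / (c * r ^ (-s)) = r ^ s := by
    rw [Real.rpow_neg hr.le]
    field_simp
  rw [radius, this, ← Real.rpow_mul hr.le, mul_one_div_cancel hs.ne', Real.rpow_one]

theorem strictAntiOn_radius (hs : 0 < s) (hc : 0 < c) : StrictAntiOn (radius s c) (Ioi 0) := by
  intro y hy z hz hyz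
  have hy' : 0 < y := hy
  exact Real.rpow_lt_rpow (div_pos hc hz).le (div_lt_div_of_pos_left hc hy hyz) (by positivity)

theorem hasDerivAt_radius (hc : 0 < c) (hx : 0 < x) :
    HasDerivAt (radius s c) (-(1 / s * (radius s c x / x))) x := by
  have h := ((hasDerivAt_id x).fun_inv hx.ne').const_mul c
  have h2 := h.rpow_const (p := 1 / s) (Or.inl (by simp only [id]; positivity))
  have h3 : HasDerivAt (radius s c) _ x := h2.congr_of_eventuallyEq
    (Eventually.of_forall fun y => by simp only [radius, div_eq_mul_inv, id])
  refine h3.congr_deriv ?_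
  simp only [id]
  rw [← div_eq_mul_inv, Real.rpow_sub_one (by positivity), ← radius]
  field_simp

/-- The radial equation at energy `h` is the equation of the oscillator with exponent `β` at
energy `κ`, in the variable `c * r ^ (-s)`. -/
structure ReducesTo (α ℓ h β s c κ : ℝ) : Prop where
  ang_ne : ℓ ≠ 0
  exp_pos : 0 < β
  exp_lt : β < 2
  pow_pos : 0 < s
  coeff_pos : 0 < c
  eq : ∀ r, 0 < r → h - potential α r - ℓ ^ 2 / (2 * r ^ 2)
    = (ℓ / c) ^ 2 * (r ^ (s - 1)) ^ 2 * (κ - oscPotential β (c * r ^ (-s)))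

theorem oscPotential_one : oscPotential β 1 = (1 - 2 / β) / 2 := by
  simp only [oscPotential, Real.one_rpow]
  ring

theorem oscPotential_neg (hβ0 : 0 < β) (hβ : β < 2) (hx : 0 < x) (hx1 : x < 1) :
    oscPotential β x < 0 := by
  have h1 := Real.rpow_lt_rpow_of_exponent_gt hx hx1 hβ
  rw [Real.rpow_two] at h1
  have h2 : x ^ β / 2 < x ^ β / β :=
    div_lt_div_of_pos_left (Real.rpow_pos_of_pos hx _) hβ0 hβ
  unfold oscPotential
  linarith

namespace ReducesTo

theorem factor_pos (H : ReducesTo α ℓ h β s c κ) (hr : 0 < r) :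
    0 < (ℓ / c) ^ 2 * (r ^ (s - 1)) ^ 2 := by
  have := div_ne_zero H.ang_ne H.coeff_pos.ne'
  have := Real.rpow_pos_of_pos hr (s - 1)
  positivity

theorem mem_apsides (H : ReducesTo α ℓ h β s c κ) :
    r ∈ apsides α ℓ h ↔ 0 < r ∧ oscPotential β (c * r ^ (-s)) = κ := by
  refine and_congr_right fun hr => ?_
  rw [H.eq r hr, mul_eq_zero, or_iff_right (H.factor_pos hr).ne', sub_eq_zero, eq_comm]

theorem effPotential_lt (H : ReducesTo α ℓ h β s c κ) (hr : 0 < r) :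
    effPotential α ℓ r < h ↔ oscPotential β (c * r ^ (-s)) < κ := by
  have := H.eq r hr
  rw [effPotential, ← sub_pos, ← sub_pos (b := oscPotential _ _), ← sub_sub, this,
    mul_pos_iff_of_pos_left (H.factor_pos hr)]

/-- Two distinct apsides give two points with the same value of `U`. As `U` is strictly increasing
on `[1, ∞)`, one of them lies in `(0, 1)`, where `U(1) < U < 0`. -/
theorem energy_bounds (H : ReducesTo α ℓ h β s c κ) (hh : h ∈ energies α ℓ) :
    oscPotential β 1 < κ ∧ κ < 0 := by
  obtain ⟨r₁, h₁, r₂, h₂, hlt, -⟩ := hh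
  obtain ⟨hr₁, e₁⟩ := H.mem_apsides.1 h₁
  obtain ⟨hr₂, e₂⟩ := H.mem_apsides.1 h₂
  have hs := H.pow_pos
  have hc := H.coeff_pos
  have hβ := H.exp_lt
  have hβ0 := H.exp_pos.ne'
  set x₁ := c * r₁ ^ (-s) with hx₁
  set x₂ := c * r₂ ^ (-s) with hx₂
  have p₁ : 0 < x₁ := mul_pos hc (Real.rpow_pos_of_pos hr₁ _)
  have p₂ : 0 < x₂ := mul_pos hc (Real.rpow_pos_of_pos hr₂ _)
  have hx : x₂ < x₁ :=
    mul_lt_mul_of_pos_left (Real.rpow_lt_rpow_of_neg hr₁ hlt (by linarith)) hc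
  have hE : oscExcess β x₁ = oscExcess β x₂ := by rw [oscExcess, oscExcess, e₁, e₂]
  have hx2 : x₂ < 1 := by
    by_contra hcon
    rw [not_lt] at hcon
    exact (strictMonoOn_oscExcess hβ0 hβ hcon (hcon.trans hx.le) hx).ne' hE
  refine ⟨?_, e₂ ▸ oscPotential_neg H.exp_pos hβ p₂ hx2⟩
  have := oscExcess_pos hβ0 hβ p₂ hx2.ne
  rw [oscExcess, e₂] at this
  linarith

end ReducesTo

/-- The amplitude, in the coordinate `oscCoord`, of the oscillation of energy `κ`. -/
def oscAmplitude (β κ : ℝ) : ℝ := √(2 * (κ - oscPotential β 1))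

theorem oscAmplitude_pos (hκ : oscPotential β 1 < κ) : 0 < oscAmplitude β κ :=
  Real.sqrt_pos.2 (by linarith)

theorem oscAmplitude_sq (hκ : oscPotential β 1 < κ) :
    oscAmplitude β κ ^ 2 = 2 * (κ - oscPotential β 1) :=
  Real.sq_sqrt (by linarith)

theorem oscAmplitude_sq_lt (hκ : oscPotential β 1 < κ) (hκ0 : κ < 0) :
    oscAmplitude β κ ^ 2 < 2 / β - 1 := by
  rw [oscAmplitude_sq hκ, oscPotential_one]
  linarith

theorem oscPotential_eq_iff (hβ0 : 0 < β) (hβ : β < 2) (hx : 0 < x)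
    (hκ : oscPotential β 1 < κ) (hκ0 : κ < 0) :
    oscPotential β x = κ ↔
      x = oscInv β (oscAmplitude β κ) ∨ x = oscInv β (-oscAmplitude β κ) := by
  have ha := oscAmplitude_sq_lt hκ hκ0
  have ha' : (-oscAmplitude β κ) ^ 2 < 2 / β - 1 := by rwa [neg_sq]
  have hsq := oscCoord_sq hβ0.ne' hβ hx
  have hasq := oscAmplitude_sq hκ
  have h1 : oscPotential β x = κ ↔ oscCoord β x ^ 2 = oscAmplitude β κ ^ 2 := by
    rw [hsq, hasq, oscExcess]
    constructor <;> intro <;> linarith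
  have inv : ∀ y, y ^ 2 < 2 / β - 1 → (oscCoord β x = y ↔ x = oscInv β y) := by
    intro y hy
    constructor
    · rintro rfl
      exact (oscInv_oscCoord hβ0.ne' hβ hx).symm
    · rintro rfl
      exact oscCoord_oscInv hβ0 hβ hy
  rw [h1, sq_eq_sq_iff_eq_or_eq_neg, inv _ ha, inv _ ha']

theorem oscPotential_lt_iff (hβ0 : 0 < β) (hβ : β < 2) (hx : 0 < x)
    (hκ : oscPotential β 1 < κ) :
    oscPotential β x < κ ↔ oscCoord β x ∈ Ioo (-oscAmplitude β κ) (oscAmplitude β κ) := by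
  have hsq := oscCoord_sq hβ0.ne' hβ hx
  have hasq := oscAmplitude_sq hκ
  have h1 : oscPotential β x < κ ↔ oscCoord β x ^ 2 < oscAmplitude β κ ^ 2 := by
    rw [hsq, hasq, oscExcess]
    constructor <;> intro <;> linarith
  rw [h1, sq_lt_sq, abs_of_pos (oscAmplitude_pos hκ), abs_lt, mem_Ioo]

theorem mem_Ioo_oscInv_iff (hβ0 : 0 < β) (hβ : β < 2) (hx : 0 < x) {a : ℝ}
    (ha : a ^ 2 < 2 / β - 1) :
    x ∈ Ioo (oscInv β (-a)) (oscInv β a) ↔ oscCoord β x ∈ Ioo (-a) a := by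
  have ha' : (-a) ^ 2 < 2 / β - 1 := by rwa [neg_sq]
  have hm := strictMonoOn_oscCoord hβ0.ne' hβ
  rw [mem_Ioo, mem_Ioo, ← hm.lt_iff_lt (oscInv_pos hβ0 hβ ha') hx,
    ← hm.lt_iff_lt hx (oscInv_pos hβ0 hβ ha), oscCoord_oscInv hβ0 hβ ha,
    oscCoord_oscInv hβ0 hβ ha']

theorem mem_Ioo_radius_iff (hs : 0 < s) (hc : 0 < c) {y z : ℝ} (hy : 0 < y) (hz : 0 < z)
    (hr : 0 < r) : r ∈ Ioo (radius s c z) (radius s c y) ↔ c * r ^ (-s) ∈ Ioo y z := by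
  have hx : 0 < c * r ^ (-s) := mul_pos hc (Real.rpow_pos_of_pos hr _)
  have hm := strictAntiOn_radius hs hc
  conv_lhs => rw [← radius_mul_rpow hs hc hr]
  rw [mem_Ioo, mem_Ioo, hm.lt_iff_gt hz hx, hm.lt_iff_gt hx hy, and_comm]

namespace ReducesTo

theorem oscInv_amplitude_pos (H : ReducesTo α ℓ h β s c κ)
    (hκ : oscPotential β 1 < κ) (hκ0 : κ < 0) : 0 < oscInv β (oscAmplitude β κ) :=
  oscInv_pos H.exp_pos H.exp_lt (oscAmplitude_sq_lt hκ hκ0)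

theorem oscInv_neg_amplitude_pos (H : ReducesTo α ℓ h β s c κ)
    (hκ : oscPotential β 1 < κ) (hκ0 : κ < 0) : 0 < oscInv β (-oscAmplitude β κ) :=
  oscInv_pos H.exp_pos H.exp_lt (by rw [neg_sq]; exact oscAmplitude_sq_lt hκ hκ0)

theorem radius_lt_radius (H : ReducesTo α ℓ h β s c κ) (hκ : oscPotential β 1 < κ) (hκ0 : κ < 0) :
    radius s c (oscInv β (oscAmplitude β κ)) < radius s c (oscInv β (-oscAmplitude β κ)) := by
  have ha := oscAmplitude_sq_lt hκ hκ0
  refine strictAntiOn_radius H.pow_pos H.coeff_pos (H.oscInv_neg_amplitude_pos hκ hκ0)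
    (H.oscInv_amplitude_pos hκ hκ0) (strictMonoOn_oscInv H.exp_pos H.exp_lt ?_ ha ?_)
  · rwa [mem_ofPred_eq, neg_sq]
  · linarith [oscAmplitude_pos hκ]

theorem apsides_eq (H : ReducesTo α ℓ h β s c κ)
    (hκ : oscPotential β 1 < κ) (hκ0 : κ < 0) : apsides α ℓ h =
    {radius s c (oscInv β (oscAmplitude β κ)), radius s c (oscInv β (-oscAmplitude β κ))} := by
  have hs := H.pow_pos
  have hc := H.coeff_pos
  have hp := H.oscInv_amplitude_pos hκ hκ0
  have hm := H.oscInv_neg_amplitude_pos hκ hκ0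
  ext r
  rw [H.mem_apsides, mem_insert_iff, mem_singleton_iff]
  constructor
  · rintro ⟨hr, he⟩
    rw [oscPotential_eq_iff H.exp_pos H.exp_lt
      (mul_pos hc (Real.rpow_pos_of_pos hr _)) hκ hκ0] at he
    refine he.imp (fun e => ?_) fun e => ?_ <;> rw [← e, radius_mul_rpow hs hc hr]
  · rintro (rfl | rfl)
    · refine ⟨radius_pos hc hp, ?_⟩
      rw [mul_radius_rpow hs hc hp, oscPotential_eq_iff H.exp_pos H.exp_lt hp hκ hκ0]
      exact Or.inl rfl
    · refine ⟨radius_pos hc hm, ?_⟩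
      rw [mul_radius_rpow hs hc hm, oscPotential_eq_iff H.exp_pos H.exp_lt hm hκ hκ0]
      exact Or.inr rfl

theorem mem_energies (H : ReducesTo α ℓ h β s c κ)
    (hκ : oscPotential β 1 < κ) (hκ0 : κ < 0) : h ∈ energies α ℓ := by
  have hs := H.pow_pos
  have hc := H.coeff_pos
  have hp := H.oscInv_amplitude_pos hκ hκ0
  have hm := H.oscInv_neg_amplitude_pos hκ hκ0
  refine ⟨radius s c (oscInv β (oscAmplitude β κ)), ?_,
    radius s c (oscInv β (-oscAmplitude β κ)), ?_, H.radius_lt_radius hκ hκ0, fun r hr => ?_⟩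
  · rw [H.apsides_eq hκ hκ0]; exact Or.inl rfl
  · rw [H.apsides_eq hκ hκ0]; exact Or.inr rfl
  · have hr0 : 0 < r := (radius_pos hc hp).trans hr.1
    have hx := mul_pos hc (Real.rpow_pos_of_pos hr0 (-s))
    rwa [H.effPotential_lt hr0, oscPotential_lt_iff H.exp_pos H.exp_lt hx hκ,
      ← mem_Ioo_oscInv_iff H.exp_pos H.exp_lt hx (oscAmplitude_sq_lt hκ hκ0),
      ← mem_Ioo_radius_iff hs hc hm hp hr0]

theorem rMinus_eq (H : ReducesTo α ℓ h β s c κ)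
    (hκ : oscPotential β 1 < κ) (hκ0 : κ < 0) :
    rMinus α ℓ h = radius s c (oscInv β (oscAmplitude β κ)) := by
  rw [rMinus, H.apsides_eq hκ hκ0, csInf_pair]
  exact min_eq_left (H.radius_lt_radius hκ hκ0).le

theorem rPlus_eq (H : ReducesTo α ℓ h β s c κ)
    (hκ : oscPotential β 1 < κ) (hκ0 : κ < 0) :
    rPlus α ℓ h = radius s c (oscInv β (-oscAmplitude β κ)) := by
  rw [rPlus, H.apsides_eq hκ hκ0, csSup_pair]
  exact max_eq_right (H.radius_lt_radius hκ hκ0).le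

/-- The length scale `c` cancels in the quotient, so the eccentricity depends on `h` only through
`κ`. The pericenter belongs to `+a` because the radius decreases in `x`. -/
theorem eccentricity_eq (H : ReducesTo α ℓ h β s c κ) (hκ : oscPotential β 1 < κ) (hκ0 : κ < 0) :
    eccentricity α ℓ h = oscEccentricity β s (oscAmplitude β κ) := by
  have hp := H.oscInv_amplitude_pos hκ hκ0
  have hm := H.oscInv_neg_amplitude_pos hκ hκ0
  have hc := H.coeff_pos
  rw [eccentricity, H.rMinus_eq hκ hκ0, H.rPlus_eq hκ hκ0, oscEccentricity, radius, radius,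
    Real.div_rpow hc.le hp.le, Real.div_rpow hc.le hm.le]
  have h1 := Real.rpow_pos_of_pos hp (1 / s)
  have h2 := Real.rpow_pos_of_pos hm (1 / s)
  have h3 := Real.rpow_pos_of_pos hc (1 / s)
  field_simp

theorem image_radius (H : ReducesTo α ℓ h β s c κ)
    (hκ : oscPotential β 1 < κ) (hκ0 : κ < 0) :
    (fun θ => radius s c (oscInv β (oscAmplitude β κ * Real.sin θ))) ''
    Ioo (-(Real.pi / 2)) (Real.pi / 2) = Ioo (rMinus α ℓ h) (rPlus α ℓ h) := by
  have hs := H.pow_pos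
  have hc := H.coeff_pos
  have hp := H.oscInv_amplitude_pos hκ hκ0
  have hm := H.oscInv_neg_amplitude_pos hκ hκ0
  have ha := oscAmplitude_sq_lt hκ hκ0
  have ha0 := oscAmplitude_pos hκ
  rw [H.rMinus_eq hκ hκ0, H.rPlus_eq hκ hκ0]
  ext r
  constructor
  · rintro ⟨θ, hθ, rfl⟩
    have hθ' := (mul_sin_sq_le (oscAmplitude β κ) θ).trans_lt ha
    have hx := oscInv_pos H.exp_pos H.exp_lt hθ'
    rw [mem_Ioo_radius_iff hs hc hm hp (radius_pos hc hx), mul_radius_rpow hs hc hx,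
      mem_Ioo_oscInv_iff H.exp_pos H.exp_lt hx ha, oscCoord_oscInv H.exp_pos H.exp_lt hθ']
    have h1 : Real.sin θ < 1 := by
      rw [← Real.sin_pi_div_two]
      exact Real.sin_lt_sin_of_lt_of_le_pi_div_two hθ.1.le le_rfl hθ.2
    have h2 : -1 < Real.sin θ := by
      rw [← Real.sin_pi_div_two, ← Real.sin_neg]
      exact Real.sin_lt_sin_of_lt_of_le_pi_div_two le_rfl hθ.2.le hθ.1
    constructor <;> nlinarith
  · intro hr
    have hr0 : 0 < r := (radius_pos hc hp).trans hr.1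
    have hx := mul_pos hc (Real.rpow_pos_of_pos hr0 (-s))
    rw [mem_Ioo_radius_iff hs hc hm hp hr0, mem_Ioo_oscInv_iff H.exp_pos H.exp_lt hx ha] at hr
    have h1 : -1 < oscCoord β (c * r ^ (-s)) / oscAmplitude β κ := by
      rw [lt_div_iff₀ ha0]; linarith [hr.1]
    have h2 : oscCoord β (c * r ^ (-s)) / oscAmplitude β κ < 1 := by
      rw [div_lt_iff₀ ha0]; linarith [hr.2]
    refine ⟨Real.arcsin (oscCoord β (c * r ^ (-s)) / oscAmplitude β κ),
      ⟨Real.neg_pi_div_two_lt_arcsin.2 h1, Real.arcsin_lt_pi_div_two.2 h2⟩, ?_⟩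
    simp only
    rw [Real.sin_arcsin h1.le h2.le, mul_div_cancel₀ _ ha0.ne',
      oscInv_oscCoord H.exp_pos.ne' H.exp_lt hx, radius_mul_rpow hs hc hr0]

theorem hasDerivAt_radius_sin (H : ReducesTo α ℓ h β s c κ)
    (hκ : oscPotential β 1 < κ) (hκ0 : κ < 0) (θ : ℝ) :
    HasDerivAt (fun θ => radius s c (oscInv β (oscAmplitude β κ * Real.sin θ)))
      (-(1 / s * (radius s c (oscInv β (oscAmplitude β κ * Real.sin θ))
        / oscInv β (oscAmplitude β κ * Real.sin θ)))
        * (oscSpeed β (oscAmplitude β κ * Real.sin θ) * (oscAmplitude β κ * Real.cos θ))) θ := by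
  have hθ' := (mul_sin_sq_le (oscAmplitude β κ) θ).trans_lt (oscAmplitude_sq_lt hκ hκ0)
  have hx := oscInv_pos H.exp_pos H.exp_lt hθ'
  exact HasDerivAt.comp (h₂ := radius s c) θ (hasDerivAt_radius H.coeff_pos hx)
    (HasDerivAt.comp (h₂ := oscInv β) θ (hasDerivAt_oscInv H.exp_pos H.exp_lt hθ')
      ((Real.hasDerivAt_sin θ).const_mul _))

/-- The radicand becomes a perfect square containing `a² - a² sin² θ = (a cos θ)²`. Its root cancels
the `a cos θ` of the Jacobian, and with it the endpoint singularities; the powers of `r` and the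
scale `c` cancel by `hmul`. -/
theorem abs_deriv_mul_integrand (H : ReducesTo α ℓ h β s c κ)
    (hκ : oscPotential β 1 < κ) (hκ0 : κ < 0)
    {θ : ℝ} (hθ : θ ∈ Ioo (-(Real.pi / 2)) (Real.pi / 2)) :
    |-(1 / s * (radius s c (oscInv β (oscAmplitude β κ * Real.sin θ))
        / oscInv β (oscAmplitude β κ * Real.sin θ)))
        * (oscSpeed β (oscAmplitude β κ * Real.sin θ) * (oscAmplitude β κ * Real.cos θ))|
      • integrand α ℓ h (radius s c (oscInv β (oscAmplitude β κ * Real.sin θ)))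
    = 1 / s * oscSpeed β (oscAmplitude β κ * Real.sin θ) := by
  have hs := H.pow_pos
  have hc := H.coeff_pos
  have ha0 := oscAmplitude_pos hκ
  have hcos := Real.cos_pos_of_mem_Ioo hθ
  have hθ' := (mul_sin_sq_le (oscAmplitude β κ) θ).trans_lt (oscAmplitude_sq_lt hκ hκ0)
  have hx := oscInv_pos H.exp_pos H.exp_lt hθ'
  have hP := oscSpeed_pos H.exp_pos H.exp_lt hθ'
  have hE := oscExcess_oscInv H.exp_pos H.exp_lt hθ'
  set a := oscAmplitude β κ with ha
  set x := oscInv β (a * Real.sin θ) with hxdef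
  have hr : 0 < radius s c x := radius_pos hc hx
  have hrs := radius_rpow hs hc hx
  have hrx := mul_radius_rpow hs hc hx
  set r := radius s c x
  have hℓ : 0 < |ℓ| := abs_pos.2 H.ang_ne
  have hrs1 : 0 < r ^ (s - 1) := Real.rpow_pos_of_pos hr _
  have hmul : r ^ (s - 1) * (r * x) = c := by
    rw [Real.rpow_sub_one hr.ne', hrs]
    field_simp
  have hrad : 2 * (h - potential α r) - ℓ ^ 2 / r ^ 2
      = (|ℓ| / c * r ^ (s - 1) * (a * Real.cos θ)) ^ 2 := by
    have h1 := H.eq r hr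
    rw [hrx] at h1
    have h2 : 2 * (κ - oscPotential β x) = (a * Real.cos θ) ^ 2 := by
      have h3 := oscAmplitude_sq hκ
      rw [oscExcess] at hE
      rw [mul_pow] at hE
      rw [← ha] at h3
      rw [mul_pow, Real.cos_sq']
      linarith
    have h4 : ℓ ^ 2 / r ^ 2 = 2 * (ℓ ^ 2 / (2 * r ^ 2)) := by field_simp
    rw [mul_pow, mul_pow, ← h2, div_pow, sq_abs, ← div_pow ℓ c, h4]
    linarith
  rw [integrand, hrad, Real.sqrt_sq (by positivity), neg_mul, abs_neg,
    abs_of_pos (by positivity), smul_eq_mul]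
  have hne : r ^ (s - 1) ≠ 0 := hrs1.ne'
  rw [← hmul]
  field_simp

theorem integrableOn_and_integral_eq (H : ReducesTo α ℓ h β s c κ)
    (hκ : oscPotential β 1 < κ) (hκ0 : κ < 0) :
    IntervalIntegrable (integrand α ℓ h) volume (rMinus α ℓ h) (rPlus α ℓ h) ∧
      apsidalAngle α ℓ h = 1 / s * oscAngle β (oscAmplitude β κ) := by
  have ha := oscAmplitude_sq_lt hκ hκ0
  have hle : rMinus α ℓ h ≤ rPlus α ℓ h := by
    rw [H.rMinus_eq hκ hκ0, H.rPlus_eq hκ hκ0]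
    exact (H.radius_lt_radius hκ hκ0).le
  have hpi : -(Real.pi / 2) ≤ Real.pi / 2 := by linarith [Real.pi_pos]
  have hd : ∀ θ ∈ Ioo (-(Real.pi / 2)) (Real.pi / 2), HasDerivWithinAt _ _ _ θ :=
    fun θ _ => (H.hasDerivAt_radius_sin hκ hκ0 θ).hasDerivWithinAt
      (s := Ioo (-(Real.pi / 2)) (Real.pi / 2))
  have hinj : InjOn (fun θ => radius s c (oscInv β (oscAmplitude β κ * Real.sin θ)))
      (Ioo (-(Real.pi / 2)) (Real.pi / 2)) := by
    intro θ hθ η hη heq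
    have hθ' := (mul_sin_sq_le (oscAmplitude β κ) θ).trans_lt ha
    have hη' := (mul_sin_sq_le (oscAmplitude β κ) η).trans_lt ha
    have h1 := (strictAntiOn_radius H.pow_pos H.coeff_pos).injOn
      (oscInv_pos H.exp_pos H.exp_lt hθ') (oscInv_pos H.exp_pos H.exp_lt hη') heq
    have h2 := (strictMonoOn_oscInv H.exp_pos H.exp_lt).injOn hθ' hη' h1
    exact Real.injOn_sin ⟨hθ.1.le, hθ.2.le⟩ ⟨hη.1.le, hη.2.le⟩
      (mul_left_cancel₀ (oscAmplitude_pos hκ).ne' h2)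
  have hcont := (continuous_oscSpeed_mul_sin H.exp_pos H.exp_lt ha).const_mul (1 / s)
  have hfun : EqOn (fun θ => _)
      (fun θ => 1 / s * oscSpeed β (oscAmplitude β κ * Real.sin θ))
      (Ioo (-(Real.pi / 2)) (Real.pi / 2)) :=
    fun θ hθ => H.abs_deriv_mul_integrand hκ hκ0 hθ
  constructor
  · rw [intervalIntegrable_iff_integrableOn_Ioo_of_le hle, ← H.image_radius hκ hκ0,
      integrableOn_image_iff_integrableOn_abs_deriv_smul measurableSet_Ioo hd hinj,
      integrableOn_congr_fun hfun measurableSet_Ioo,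
      ← intervalIntegrable_iff_integrableOn_Ioo_of_le hpi]
    exact hcont.intervalIntegrable _ _
  · rw [apsidalAngle, intervalIntegral.integral_of_le hle, integral_Ioc_eq_integral_Ioo,
      ← H.image_radius hκ hκ0,
      integral_image_eq_integral_abs_deriv_smul measurableSet_Ioo hd hinj,
      setIntegral_congr_fun measurableSet_Ioo hfun, ← integral_Ioc_eq_integral_Ioo,
      ← intervalIntegral.integral_of_le hpi, intervalIntegral.integral_const_mul, oscAngle]

end ReducesTo

end

/-! ### Monotonicity in the energy, and transfer to an increasing parameter. -/

section

theorem increasesOn_of_hasDerivAt {f : ℝ → ℝ} {H : Set ℝ} (hH : Convex ℝ H)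
    (hd : ∀ x ∈ H, ∃ d, 0 < d ∧ HasDerivAt f d x) : IncreasesOn f H := by
  have hpos : ∀ x ∈ H, DifferentiableAt ℝ f x ∧ 0 < deriv f x := fun x hx => by
    obtain ⟨d, hd0, hd⟩ := hd x hx
    exact ⟨hd.differentiableAt, hd.deriv.symm ▸ hd0⟩
  exact ⟨strictMonoOn_of_deriv_pos hH
    (fun x hx => (hpos x hx).1.continuousAt.continuousWithinAt)
    fun x hx => (hpos x (interior_subset hx)).2, hpos⟩

theorem decreasesOn_of_hasDerivAt {f : ℝ → ℝ} {H : Set ℝ} (hH : Convex ℝ H)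
    (hd : ∀ x ∈ H, ∃ d, d < 0 ∧ HasDerivAt f d x) : DecreasesOn f H := by
  have hneg : ∀ x ∈ H, DifferentiableAt ℝ f x ∧ deriv f x < 0 := fun x hx => by
    obtain ⟨d, hd0, hd⟩ := hd x hx
    exact ⟨hd.differentiableAt, hd.deriv.symm ▸ hd0⟩
  exact ⟨strictAntiOn_of_deriv_neg hH
    (fun x hx => (hneg x hx).1.continuousAt.continuousWithinAt)
    fun x hx => (hneg x (interior_subset hx)).2, hneg⟩

/-- A function on an open set is a function of any increasing parameter, with the same
monotonicity. -/
theorem exists_function_of_parameter {H : Set ℝ} (hH : IsOpen H) {e : ℝ → ℝ}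
    (he : IncreasesOn e H) (F : ℝ → ℝ) :
    ∃ T : ℝ → ℝ, (∀ h ∈ H, F h = T (e h)) ∧
      (MonotoneOn F H → MonotoneOn T (e '' H)) ∧ (AntitoneOn F H → AntitoneOn T (e '' H)) ∧
      (DecreasesOn F H → DecreasesOn T (e '' H)) ∧
      (IncreasesOn F H → IncreasesOn T (e '' H)) := by
  -- The values of this inverse off `e '' H` are arbitrary, but `e '' H` is a neighborhood of each
  -- of its points, so they do not affect the derivatives.
  set k := Function.invFunOn e H
  have hk : ∀ h ∈ H, k (e h) = h := he.1.injOn.leftInvOn_invFunOn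
  have hT : ∀ h ∈ H, HasDerivAt k (deriv e h)⁻¹ (e h) := fun h hh =>
    (hasDerivAt_leftInverse hH he.1 (fun x hx => (he.2 x hx).1.hasDerivAt) hk hh
      (he.2 h hh).2.ne').2
  have hd : ∀ h ∈ H, DifferentiableAt ℝ F h →
      HasDerivAt (F ∘ k) (deriv F h * (deriv e h)⁻¹) (e h) := fun h hh hF => by
    refine HasDerivAt.comp (e h) ?_ (hT h hh)
    rw [hk h hh]
    exact hF.hasDerivAt
  refine ⟨F ∘ k, fun h hh => by rw [Function.comp, hk h hh], ?_, ?_, ?_, ?_⟩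
  · rintro hF _ ⟨y, hy, rfl⟩ _ ⟨z, hz, rfl⟩ hyz
    simp only [Function.comp, hk y hy, hk z hz]
    exact hF hy hz ((he.1.le_iff_le hy hz).1 hyz)
  · rintro hF _ ⟨y, hy, rfl⟩ _ ⟨z, hz, rfl⟩ hyz
    simp only [Function.comp, hk y hy, hk z hz]
    exact hF hy hz ((he.1.le_iff_le hy hz).1 hyz)
  · rintro hF
    constructor
    · rintro _ ⟨y, hy, rfl⟩ _ ⟨z, hz, rfl⟩ hyz
      simp only [Function.comp, hk y hy, hk z hz]
      exact hF.1 hy hz ((he.1.lt_iff_lt hy hz).1 hyz)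
    · rintro _ ⟨y, hy, rfl⟩
      have := hd y hy (hF.2 y hy).1
      refine ⟨this.differentiableAt, ?_⟩
      rw [this.deriv]
      exact mul_neg_of_neg_of_pos (hF.2 y hy).2 (inv_pos.2 (he.2 y hy).2)
  · rintro hF
    constructor
    · rintro _ ⟨y, hy, rfl⟩ _ ⟨z, hz, rfl⟩ hyz
      simp only [Function.comp, hk y hy, hk z hz]
      exact hF.1 hy hz ((he.1.lt_iff_lt hy hz).1 hyz)
    · rintro _ ⟨y, hy, rfl⟩
      have := hd y hy (hF.2 y hy).1
      refine ⟨this.differentiableAt, ?_⟩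
      rw [this.deriv]
      exact mul_pos (hF.2 y hy).2 (inv_pos.2 (he.2 y hy).2)

theorem exists_hasDerivAt_oscAmplitude {β h : ℝ} {κ : ℝ → ℝ} (hκ : oscPotential β 1 < κ h)
    (hκ' : ∃ d, 0 < d ∧ HasDerivAt κ d h) :
    ∃ d, 0 < d ∧ HasDerivAt (fun h => oscAmplitude β (κ h)) d h := by
  obtain ⟨d, hd, hκd⟩ := hκ'
  have hpos : 0 < 2 * (κ h - oscPotential β 1) := by linarith
  refine ⟨_, ?_, ((hκd.sub_const (oscPotential β 1)).const_mul 2).sqrt hpos.ne'⟩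
  have := Real.sqrt_pos.2 hpos
  positivity

section Monotonicity

variable {α ℓ β s : ℝ} {H : Set ℝ} {κ c : ℝ → ℝ}

/-- The scale `c` may vary with `h` without any regularity, since it has dropped out; only `κ` has
to be differentiated. -/
theorem increasesOn_eccentricity (hH : IsOpen H) (hcv : Convex ℝ H)
    (hR : ∀ h ∈ H, ReducesTo α ℓ h β s (c h) (κ h))
    (hκ : ∀ h ∈ H, oscPotential β 1 < κ h ∧ κ h < 0)
    (hκ' : ∀ h ∈ H, ∃ d, 0 < d ∧ HasDerivAt κ d h) : IncreasesOn (eccentricity α ℓ) H := by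
  refine increasesOn_of_hasDerivAt hcv fun h hh => ?_
  obtain ⟨d, hd, hA⟩ := exists_hasDerivAt_oscAmplitude (hκ h hh).1 (hκ' h hh)
  obtain ⟨e', he', hE⟩ := exists_hasDerivAt_oscEccentricity (hR h hh).exp_pos (hR h hh).exp_lt
    (hR h hh).pow_pos (oscAmplitude_sq_lt (hκ h hh).1 (hκ h hh).2)
  refine ⟨e' * d, mul_pos he' hd, (HasDerivAt.comp h hE hA).congr_of_eventuallyEq ?_⟩
  filter_upwards [hH.mem_nhds hh] with y hy
  exact (hR y hy).eccentricity_eq (hκ y hy).1 (hκ y hy).2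

theorem exists_hasDerivAt_apsidalAngle (hH : IsOpen H)
    (hR : ∀ h ∈ H, ReducesTo α ℓ h β s (c h) (κ h))
    (hκ : ∀ h ∈ H, oscPotential β 1 < κ h ∧ κ h < 0)
    (hκ' : ∀ h ∈ H, ∃ d, 0 < d ∧ HasDerivAt κ d h) {h : ℝ} (hh : h ∈ H) :
    ∃ d, 0 < d ∧
      HasDerivAt (apsidalAngle α ℓ) (d * deriv (oscAngle β) (oscAmplitude β (κ h))) h := by
  obtain ⟨d, hd, hA⟩ := exists_hasDerivAt_oscAmplitude (hκ h hh).1 (hκ' h hh)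
  have hΘ := (hasDerivAt_oscAngle (hR h hh).exp_pos (hR h hh).exp_lt
    (oscAmplitude_sq_lt (hκ h hh).1 (hκ h hh).2)).differentiableAt.hasDerivAt
  have hs := (hR h hh).pow_pos
  refine ⟨1 / s * d, by positivity, (((HasDerivAt.comp h hΘ hA).const_mul
    (1 / s)).congr_of_eventuallyEq ?_).congr_deriv (by ring)⟩
  filter_upwards [hH.mem_nhds hh] with y hy
  exact ((hR y hy).integrableOn_and_integral_eq (hκ y hy).1 (hκ y hy).2).2

theorem decreasesOn_apsidalAngle (hH : IsOpen H) (hcv : Convex ℝ H)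
    (hR : ∀ h ∈ H, ReducesTo α ℓ h β s (c h) (κ h))
    (hκ : ∀ h ∈ H, oscPotential β 1 < κ h ∧ κ h < 0)
    (hκ' : ∀ h ∈ H, ∃ d, 0 < d ∧ HasDerivAt κ d h) (hβ2 : 1 / 2 < β) (hβ1 : β < 1) :
    DecreasesOn (apsidalAngle α ℓ) H := by
  refine decreasesOn_of_hasDerivAt hcv fun h hh => ?_
  obtain ⟨d, hd, hA⟩ := exists_hasDerivAt_apsidalAngle hH hR hκ hκ' hh
  exact ⟨_, mul_neg_of_pos_of_neg hd (deriv_oscAngle_neg hβ2 hβ1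
    (oscAmplitude_pos (hκ h hh).1) (oscAmplitude_sq_lt (hκ h hh).1 (hκ h hh).2)), hA⟩

theorem increasesOn_apsidalAngle (hH : IsOpen H) (hcv : Convex ℝ H)
    (hR : ∀ h ∈ H, ReducesTo α ℓ h β s (c h) (κ h))
    (hκ : ∀ h ∈ H, oscPotential β 1 < κ h ∧ κ h < 0)
    (hκ' : ∀ h ∈ H, ∃ d, 0 < d ∧ HasDerivAt κ d h) (hβ1 : 1 < β) (hβ : β < 2) :
    IncreasesOn (apsidalAngle α ℓ) H := by
  refine increasesOn_of_hasDerivAt hcv fun h hh => ?_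
  obtain ⟨d, hd, hA⟩ := exists_hasDerivAt_apsidalAngle hH hR hκ hκ' hh
  exact ⟨_, mul_pos hd (deriv_oscAngle_pos hβ1 hβ
    (oscAmplitude_pos (hκ h hh).1) (oscAmplitude_sq_lt (hκ h hh).1 (hκ h hh).2)), hA⟩

theorem monotoneOn_apsidalAngle_of_eq_one (hH : IsOpen H) (hcv : Convex ℝ H)
    (hR : ∀ h ∈ H, ReducesTo α ℓ h β s (c h) (κ h))
    (hκ : ∀ h ∈ H, oscPotential β 1 < κ h ∧ κ h < 0)
    (hκ' : ∀ h ∈ H, ∃ d, 0 < d ∧ HasDerivAt κ d h) (hβ1 : β = 1) :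
    MonotoneOn (apsidalAngle α ℓ) H := by
  have hd : ∀ h ∈ H, HasDerivAt (apsidalAngle α ℓ) 0 h := fun h hh => by
    obtain ⟨d, hd, hA⟩ := exists_hasDerivAt_apsidalAngle hH hR hκ hκ' hh
    subst hβ1
    have := oscAmplitude_sq_lt (hκ h hh).1 (hκ h hh).2
    rwa [deriv_oscAngle_one (by linarith), mul_zero] at hA
  exact monotoneOn_of_deriv_nonneg hcv
    (fun h hh => (hd h hh).continuousAt.continuousWithinAt)
    (fun h hh => (hd h (interior_subset hh)).differentiableAt.differentiableWithinAt)
    fun h hh => (hd h (interior_subset hh)).deriv.ge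

end Monotonicity

/-! ### The two reductions and the range of energies. -/

/-- For `0 < α < 2` the inverse radius is an oscillator with exponent `α`. -/
theorem reducesTo_of_pos {ℓ α : ℝ} (hℓ : ℓ ≠ 0) (hα0 : 0 < α) (hα : α < 2) (h : ℝ) :
    ReducesTo α ℓ h α 1 (|ℓ| / |ℓ| ^ (α / (α - 2))) (h / |ℓ| ^ (2 * α / (α - 2))) := by
  have hl : 0 < |ℓ| := abs_pos.2 hℓ
  have hlam : 0 < |ℓ| ^ (α / (α - 2)) := Real.rpow_pos_of_pos hl _
  have hα2 : α - 2 ≠ 0 := by linarith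
  have hsq : |ℓ| ^ (2 * α / (α - 2)) = (|ℓ| ^ (α / (α - 2))) ^ 2 := by
    rw [← Real.rpow_natCast, ← Real.rpow_mul hl.le]
    congr 1
    push_cast
    ring
  -- This identity fixes the scale: it gives the power term the coefficient `1/α` of the original
  -- potential.
  have hone : (|ℓ| ^ (α / (α - 2))) ^ 2 * (|ℓ| / |ℓ| ^ (α / (α - 2))) ^ α = 1 := by
    have h1 : |ℓ| / |ℓ| ^ (α / (α - 2)) = |ℓ| ^ (1 - α / (α - 2)) := by
      rw [Real.rpow_sub hl, Real.rpow_one]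
    rw [← hsq, h1, ← Real.rpow_mul hl.le, ← Real.rpow_add hl]
    have : 2 * α / (α - 2) + (1 - α / (α - 2)) * α = 0 := by
      field_simp
      ring
    rw [this, Real.rpow_zero]
  rw [hsq]
  set L := |ℓ| ^ (α / (α - 2))
  refine ⟨hℓ, hα0, hα, one_pos, div_pos hl hlam, fun r hr => ?_⟩
  have hc0 : 0 < |ℓ| / L := div_pos hl hlam
  have e1 : (ℓ / (|ℓ| / L)) ^ 2 = L ^ 2 := by
    rw [div_div_eq_mul_div, div_pow, mul_pow, ← sq_abs ℓ]
    field_simp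
  have e2 : (|ℓ| / L * r ^ (-1 : ℝ)) ^ α = (|ℓ| / L) ^ α * r ^ (-α) := by
    rw [Real.mul_rpow hc0.le (Real.rpow_pos_of_pos hr _).le, ← Real.rpow_mul hr.le]
    ring_nf
  have e3 : (|ℓ| / L * r ^ (-1 : ℝ)) ^ 2 = ℓ ^ 2 / L ^ 2 / r ^ 2 := by
    rw [Real.rpow_neg_one, mul_pow, div_pow, sq_abs, inv_pow]
    rfl
  rw [e1, oscPotential, e2, e3, sub_self, Real.rpow_zero, potential]
  have : L ^ 2 * ((|ℓ| / L) ^ α * r ^ (-α) / α) = r ^ (-α) / α := by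
    rw [← mul_div_assoc, ← mul_assoc, hone, one_mul]
  rw [one_pow, mul_one, mul_sub, mul_sub, this]
  field_simp
  ring

/-- For `α < 0` a power of the inverse radius is an oscillator with the dual exponent
`2α/(α-2)`. -/
theorem reducesTo_of_neg {ℓ α h : ℝ} (hℓ : ℓ ≠ 0) (hα : α < 0) (hh : 0 < h) :
    ReducesTo α ℓ h (2 * α / (α - 2)) ((2 - α) / 2)
      ((ℓ ^ 2 / (2 * α / (α - 2)) * h⁻¹) ^ ((2 - α) / 4))
      ((ℓ ^ 2 / (2 * α / (α - 2)) * h⁻¹) ^ ((2 - α) / 2) / (α * ℓ ^ 2)) := by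
  have hα2 : α - 2 < 0 := by linarith
  have hα2' : α - 2 ≠ 0 := hα2.ne
  have hβ0 : 0 < 2 * α / (α - 2) := div_pos_of_neg_of_neg (by linarith) hα2
  have hβ2 : 2 * α / (α - 2) < 2 := by
    rw [div_lt_iff_of_neg hα2]
    linarith
  have hℓ2 : 0 < ℓ ^ 2 := by positivity
  set β := 2 * α / (α - 2) with hβ
  set u := ℓ ^ 2 / β * h⁻¹ with hu
  have hu0 : 0 < u := by positivity
  set c := u ^ ((2 - α) / 4) with hc
  have hc0 : 0 < c := Real.rpow_pos_of_pos hu0 _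
  have hc2 : u ^ ((2 - α) / 2) = c ^ 2 := by
    rw [hc, ← Real.rpow_natCast, ← Real.rpow_mul hu0.le]
    congr 1
    push_cast
    ring
  -- The choice of `c` is the solution of this equation, which makes the term `x^β/β` reproduce `h`.
  -- The exponents fit because `s * β = -α` and `2(s-1) = -α`, so after the factor `r^(-α)` the
  -- power term is constant in `r`, `κ` gives the force potential and `x²/2` the centrifugal term.
  have hcβ : c ^ 2 = u * c ^ β := by
    rw [← hc2, hc, ← Real.rpow_mul hu0.le]
    nth_rewrite 2 [← Real.rpow_one u]
    rw [← Real.rpow_add hu0]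
    congr 1
    rw [hβ]
    field_simp
    ring
  rw [hc2]
  refine ⟨hℓ, hβ0, hβ2, by linarith, hc0, fun r hr => ?_⟩
  have e1 : (r ^ ((2 - α) / 2 - 1)) ^ 2 = r ^ (-α) := by
    rw [← Real.rpow_natCast, ← Real.rpow_mul hr.le]
    congr 1
    push_cast
    ring
  have e2 : (c * r ^ (-((2 - α) / 2))) ^ 2 = c ^ 2 * (r ^ α / r ^ 2) := by
    rw [mul_pow, ← Real.rpow_natCast (r ^ _), ← Real.rpow_mul hr.le, ← Real.rpow_two r,
      ← Real.rpow_sub hr]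
    congr 2
    push_cast
    ring
  have e3 : (c * r ^ (-((2 - α) / 2))) ^ β = c ^ β * r ^ α := by
    rw [Real.mul_rpow hc0.le (Real.rpow_pos_of_pos hr _).le, ← Real.rpow_mul hr.le]
    congr 2
    rw [hβ]
    field_simp
    ring
  have e4 : ℓ ^ 2 * c ^ β = c ^ 2 * (β * h) := by
    rw [hcβ, hu]
    field_simp
  rw [e1, oscPotential, e2, e3, potential, div_pow, Real.rpow_neg hr.le]
  have hrα : 0 < r ^ α := Real.rpow_pos_of_pos hr _
  have hα0 : α ≠ 0 := hα.ne
  have e5 : c ^ β = c ^ 2 * (β * h) / ℓ ^ 2 := by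
    rw [← e4]
    field_simp
  rw [e5]
  have hβ0' := hβ0.ne'
  clear_value β u c
  field_simp
  ring

theorem oscEnergy_bounds_iff_of_pos {ℓ α : ℝ} (hℓ : ℓ ≠ 0) (hα0 : 0 < α) (h : ℝ) :
    (oscPotential α 1 < h / |ℓ| ^ (2 * α / (α - 2)) ∧ h / |ℓ| ^ (2 * α / (α - 2)) < 0) ↔
      h ∈ Ioo ((α - 2) / (2 * α) * |ℓ| ^ (2 * α / (α - 2))) 0 := by
  have hL : 0 < |ℓ| ^ (2 * α / (α - 2)) := Real.rpow_pos_of_pos (abs_pos.2 hℓ) _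
  have h1 : oscPotential α 1 = (α - 2) / (2 * α) := by
    rw [oscPotential_one]
    field_simp
  rw [h1, lt_div_iff₀ hL, div_lt_iff₀ hL, zero_mul, mem_Ioo]

/-- Both sides are written over the negative number `αℓ²`, which reverses the comparison. Taking the
root of order `(2-α)/2` and inverting `h` then gives the bound on `h`. -/
theorem oscPotential_one_lt_iff_of_neg {ℓ α h : ℝ} (hℓ : ℓ ≠ 0) (hα : α < 0) (hh : 0 < h) :
    oscPotential (2 * α / (α - 2)) 1
        < (ℓ ^ 2 / (2 * α / (α - 2)) * h⁻¹) ^ ((2 - α) / 2) / (α * ℓ ^ 2) ↔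
      (α - 2) / (2 * α) * |ℓ| ^ (2 * α / (α - 2)) < h := by
  have hα2 : α - 2 < 0 := by linarith
  have hα2' : α - 2 ≠ 0 := hα2.ne
  have hα0 : α ≠ 0 := hα.ne
  have hβ0 : 0 < 2 * α / (α - 2) := div_pos_of_neg_of_neg (by linarith) hα2
  have hℓ2 : 0 < ℓ ^ 2 := by positivity
  have h1 : oscPotential (2 * α / (α - 2)) 1 = ℓ ^ 2 / (α * ℓ ^ 2) := by
    rw [oscPotential_one]
    field_simp
    ring
  have hden : α * ℓ ^ 2 < 0 := mul_neg_of_neg_of_pos hα hℓ2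
  have hroot : ℓ ^ 2 = ((ℓ ^ 2) ^ (2 / (2 - α))) ^ ((2 - α) / 2) := by
    rw [← Real.rpow_mul hℓ2.le]
    have : 2 / (2 - α) * ((2 - α) / 2) = 1 := by
      have : 2 - α ≠ 0 := by linarith
      field_simp
    rw [this, Real.rpow_one]
  have hpow : ℓ ^ 2 = (ℓ ^ 2) ^ (2 / (2 - α)) * |ℓ| ^ (2 * α / (α - 2)) := by
    have hl : 0 < |ℓ| := abs_pos.2 hℓ
    rw [← sq_abs, ← Real.rpow_natCast, ← Real.rpow_mul hl.le, ← Real.rpow_add hl]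
    congr 1
    have : 2 - α ≠ 0 := by linarith
    rw [show α - 2 = -(2 - α) by ring]
    push_cast
    field_simp
    ring
  have hx : 0 < (ℓ ^ 2) ^ (2 / (2 - α)) := Real.rpow_pos_of_pos hℓ2 _
  have hL : 0 < |ℓ| ^ (2 * α / (α - 2)) := Real.rpow_pos_of_pos (abs_pos.2 hℓ) _
  rw [h1, div_lt_div_right_of_neg hden]
  nth_rewrite 2 [hroot]
  rw [Real.rpow_lt_rpow_iff (by positivity) hx.le (by linarith), ← div_eq_mul_inv,
    div_lt_iff₀ hh]
  nth_rewrite 1 [hpow]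
  rw [mul_div_assoc, mul_lt_mul_iff_right₀ hx, ← inv_div (2 * α), inv_mul_eq_div]

theorem pos_of_mem_energies {ℓ α h : ℝ} (hα : α < 0) (hh : h ∈ energies α ℓ) : 0 < h := by
  obtain ⟨r, ⟨hr, he⟩, -⟩ := hh
  have h1 : 0 < potential α r := by
    have : 0 < -(1 / α) := neg_pos.2 (one_div_neg.2 hα)
    exact mul_pos this (Real.rpow_pos_of_pos hr _)
  have h2 : 0 ≤ ℓ ^ 2 / (2 * r ^ 2) := by positivity
  linarith

theorem energy_pos_of_gt {ℓ α h : ℝ} (hα : α < 0)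
    (hh : (α - 2) / (2 * α) * |ℓ| ^ (2 * α / (α - 2)) < h) : 0 < h := by
  refine lt_of_le_of_lt (mul_nonneg ?_ (by positivity)) hh
  exact div_nonneg_of_nonpos (by linarith) (by linarith)

theorem energies_eq_of_pos {ℓ α : ℝ} (hℓ : ℓ ≠ 0) (hα0 : 0 < α) (hα : α < 2) :
    energies α ℓ = Ioo ((α - 2) / (2 * α) * |ℓ| ^ (2 * α / (α - 2))) 0 := by
  ext h
  have H := reducesTo_of_pos hℓ hα0 hα h
  rw [← oscEnergy_bounds_iff_of_pos hℓ hα0]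
  exact ⟨H.energy_bounds, fun hκ => H.mem_energies hκ.1 hκ.2⟩

theorem dual_energy_neg {ℓ α h : ℝ} (hℓ : ℓ ≠ 0) (hα : α < 0) (hh : 0 < h) :
    (ℓ ^ 2 / (2 * α / (α - 2)) * h⁻¹) ^ ((2 - α) / 2) / (α * ℓ ^ 2) < 0 := by
  have hβ0 : 0 < 2 * α / (α - 2) := div_pos_of_neg_of_neg (by linarith) (by linarith)
  have hℓ2 : 0 < ℓ ^ 2 := by positivity
  exact div_neg_of_pos_of_neg (Real.rpow_pos_of_pos (by positivity) _)
    (mul_neg_of_neg_of_pos hα hℓ2)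

theorem energies_eq_of_neg {ℓ α : ℝ} (hℓ : ℓ ≠ 0) (hα : α < 0) :
    energies α ℓ = Ioi ((α - 2) / (2 * α) * |ℓ| ^ (2 * α / (α - 2))) := by
  ext h
  constructor
  · intro hh
    have h0 := pos_of_mem_energies hα hh
    exact (oscPotential_one_lt_iff_of_neg hℓ hα h0).1
      ((reducesTo_of_neg hℓ hα h0).energy_bounds hh).1
  · intro hh
    have h0 := energy_pos_of_gt hα hh
    exact (reducesTo_of_neg hℓ hα h0).mem_energies ((oscPotential_one_lt_iff_of_neg hℓ hα h0).2 hh)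
      (dual_energy_neg hℓ hα h0)

theorem exists_hasDerivAt_dual_energy {ℓ α h : ℝ} (hℓ : ℓ ≠ 0) (hα : α < 0) (hh : 0 < h) :
    ∃ d, 0 < d ∧ HasDerivAt (fun h : ℝ =>
      (ℓ ^ 2 / (2 * α / (α - 2)) * h⁻¹) ^ ((2 - α) / 2) / (α * ℓ ^ 2)) d h := by
  have hβ0 : 0 < 2 * α / (α - 2) := div_pos_of_neg_of_neg (by linarith) (by linarith)
  have hℓ2 : 0 < ℓ ^ 2 := by positivity
  have hu : 0 < ℓ ^ 2 / (2 * α / (α - 2)) * h⁻¹ := by positivity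
  refine ⟨_, ?_, ((((hasDerivAt_inv hh.ne').const_mul (ℓ ^ 2 / (2 * α / (α - 2)))).rpow_const
    (p := (2 - α) / 2) (Or.inl hu.ne')).div_const (α * ℓ ^ 2))⟩
  refine div_pos_of_neg_of_neg ?_ (mul_neg_of_neg_of_pos hα hℓ2)
  refine mul_neg_of_neg_of_pos (mul_neg_of_neg_of_pos ?_ (by linarith))
    (Real.rpow_pos_of_pos hu _)
  exact mul_neg_of_pos_of_neg (by positivity) (neg_neg_of_pos (by positivity))

/-- The energies form an open interval, on which the radial motion reduces to an oscillator whose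
energy is an increasing function of `h`. -/
theorem exists_reduction {ℓ α : ℝ} (hℓ : ℓ ≠ 0)
    (hα : α ∈ Iio (-2 / 3 : ℝ) ∪ Ioo (1 / 2 : ℝ) 2) :
    ∃ (β s : ℝ) (c κ : ℝ → ℝ), (1 / 2 < β ∧ β < 2) ∧
      (α ∈ Ioo (-2 : ℝ) (-2 / 3) ∪ Ioo (1 / 2 : ℝ) 1 → β < 1) ∧
      (α ∈ Iio (-2 : ℝ) ∪ Ioo (1 : ℝ) 2 → 1 < β) ∧
      IsOpen (energies α ℓ) ∧ Convex ℝ (energies α ℓ) ∧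
      (∀ h ∈ energies α ℓ, ReducesTo α ℓ h β s (c h) (κ h)) ∧
      (∀ h ∈ energies α ℓ, oscPotential β 1 < κ h ∧ κ h < 0) ∧
      ∀ h ∈ energies α ℓ, ∃ d, 0 < d ∧ HasDerivAt κ d h := by
  rcases hα with hα | hα
  · have hα' : α < -2 / 3 := hα
    have hα0 : α < 0 := by linarith
    have hα2 : α - 2 < 0 := by linarith
    have hpos : ∀ h ∈ energies α ℓ, 0 < h := fun h hh => pos_of_mem_energies hα0 hh
    -- The dual exponent decreases in `α < 0`, tends to `2` at `-∞`, equals `1` at `α = -2` and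
    -- `1/2` at `α = -2/3`.
    refine ⟨2 * α / (α - 2), (2 - α) / 2, _, _, ⟨?_, ?_⟩, ?_, ?_, ?_, ?_,
      fun h hh => reducesTo_of_neg hℓ hα0 (hpos h hh),
      fun h hh => (reducesTo_of_neg hℓ hα0 (hpos h hh)).energy_bounds hh,
      fun h hh => exists_hasDerivAt_dual_energy hℓ hα0 (hpos h hh)⟩
    · rw [lt_div_iff_of_neg hα2]; linarith
    · rw [div_lt_iff_of_neg hα2]; linarith
    · rintro (h | h)
      · rw [div_lt_iff_of_neg hα2]; linarith [h.1]
      · linarith [h.1]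
    · rintro (h | h)
      · rw [lt_div_iff_of_neg hα2]; linarith [mem_Iio.1 h]
      · linarith [h.1]
    · rw [energies_eq_of_neg hℓ hα0]; exact isOpen_Ioi
    · rw [energies_eq_of_neg hℓ hα0]; exact convex_Ioi _
  · have hα0 : 0 < α := by linarith [hα.1]
    refine ⟨α, 1, fun _ => |ℓ| / |ℓ| ^ (α / (α - 2)), fun h => h / |ℓ| ^ (2 * α / (α - 2)),
      hα, ?_, ?_, ?_, ?_, fun h _ => reducesTo_of_pos hℓ hα0 hα.2 h,
      fun h hh => (reducesTo_of_pos hℓ hα0 hα.2 h).energy_bounds hh, fun h _ => ?_⟩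
    · rintro (h | h)
      · linarith [h.2]
      · exact h.2
    · rintro (h | h)
      · linarith [mem_Iio.1 h]
      · exact h.1
    · rw [energies_eq_of_pos hℓ hα0 hα.2]; exact isOpen_Ioo
    · rw [energies_eq_of_pos hℓ hα0 hα.2]; exact convex_Ioo _ _
    · have hL : 0 < |ℓ| ^ (2 * α / (α - 2)) := Real.rpow_pos_of_pos (abs_pos.2 hℓ) _
      exact ⟨_, by positivity, (hasDerivAt_id h).div_const _⟩

end

end ApsidalAngle

end

open ApsidalAngle in
theorem theorem1 (ℓ : ℝ) (hℓ : ℓ ≠ 0) (α : ℝ)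
    (hα : α ∈ Set.Iio (-2 / 3 : ℝ) ∪ Set.Ioo (1 / 2 : ℝ) 2) :
    -- the range of energies, and convergence of the integral defining the apsidal angle
    (0 < α → energies α ℓ =
      Set.Ioo ((α - 2) / (2 * α) * |ℓ| ^ (2 * α / (α - 2))) 0) ∧
    (α < 0 → energies α ℓ =
      Set.Ioi ((α - 2) / (2 * α) * |ℓ| ^ (2 * α / (α - 2)))) ∧
    (∀ h ∈ energies α ℓ, IntervalIntegrable (integrand α ℓ h) MeasureTheory.volume
      (rMinus α ℓ h) (rPlus α ℓ h)) ∧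
    -- monotonicity in the energy
    (MonotoneOn (apsidalAngle α ℓ) (energies α ℓ) ∨
      AntitoneOn (apsidalAngle α ℓ) (energies α ℓ)) ∧
    (α ∈ Set.Ioo (-2 : ℝ) (-2 / 3) ∪ Set.Ioo (1 / 2 : ℝ) 1 →
      DecreasesOn (apsidalAngle α ℓ) (energies α ℓ)) ∧
    (α ∈ Set.Iio (-2 : ℝ) ∪ Set.Ioo (1 : ℝ) 2 →
      IncreasesOn (apsidalAngle α ℓ) (energies α ℓ)) ∧
    -- monotonicity in the eccentricity
    IncreasesOn (eccentricity α ℓ) (energies α ℓ) ∧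
    ∃ T : ℝ → ℝ,
      (∀ h ∈ energies α ℓ, apsidalAngle α ℓ h = T (eccentricity α ℓ h)) ∧
      (MonotoneOn T (eccentricity α ℓ '' energies α ℓ) ∨
        AntitoneOn T (eccentricity α ℓ '' energies α ℓ)) ∧
      (α ∈ Set.Ioo (-2 : ℝ) (-2 / 3) ∪ Set.Ioo (1 / 2 : ℝ) 1 →
        DecreasesOn T (eccentricity α ℓ '' energies α ℓ)) ∧
      (α ∈ Set.Iio (-2 : ℝ) ∪ Set.Ioo (1 : ℝ) 2 →
        IncreasesOn T (eccentricity α ℓ '' energies α ℓ)) := by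
  obtain ⟨β, s, c, κ, hβ, hβlt, hβgt, hopen, hconv, hR, hκ, hκ'⟩ := exists_reduction hℓ hα
  have hecc := increasesOn_eccentricity hopen hconv hR hκ hκ'
  have hdec : β < 1 → DecreasesOn (apsidalAngle α ℓ) (energies α ℓ) :=
    decreasesOn_apsidalAngle hopen hconv hR hκ hκ' hβ.1
  have hinc : 1 < β → IncreasesOn (apsidalAngle α ℓ) (energies α ℓ) :=
    fun h => increasesOn_apsidalAngle hopen hconv hR hκ hκ' h hβ.2
  have hmono : MonotoneOn (apsidalAngle α ℓ) (energies α ℓ) ∨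
      AntitoneOn (apsidalAngle α ℓ) (energies α ℓ) := by
    -- The middle case covers `α = 1` and `α = -2`, where the angle is constant; it is the reason
    -- the general claim is not strict.
    rcases lt_trichotomy β 1 with h | h | h
    · exact Or.inr (hdec h).1.antitoneOn
    · exact Or.inl (monotoneOn_apsidalAngle_of_eq_one hopen hconv hR hκ hκ' h)
    · exact Or.inl (hinc h).1.monotoneOn
  obtain ⟨T, hT, hTm, hTa, hTd, hTi⟩ := exists_function_of_parameter hopen hecc
    (apsidalAngle α ℓ)
  refine ⟨fun h0 => ?_, fun h0 => energies_eq_of_neg hℓ h0, fun h hh =>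
    ((hR h hh).integrableOn_and_integral_eq (hκ h hh).1 (hκ h hh).2).1, hmono,
    fun h => hdec (hβlt h), fun h => hinc (hβgt h), hecc, T, hT, hmono.imp hTm hTa,
    fun h => hTd (hdec (hβlt h)), fun h => hTi (hinc (hβgt h))⟩
  rcases hα with h | h
  · have : α < -2 / 3 := h
    linarith
  · exact energies_eq_of_pos hℓ h0 h.2
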